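/- **Theorem 4.3.** Let $\mathbb S^1=\mathbb R/\mathbb Z$. Let $f:\mathbb R\to\mathbb R$ be a $C^\infty$ function with $\lim_{x\to\pm\infty}f(x)=+\infty$, and put $\hat\gamma_k(x)=(f'(x),\dots,f^{(k)}(x))\in\mathbb R^k$. Suppose that for both $k=2$ and $k=3$ the function $f$ is *$k$-good*: $\hat\gamma_k$ never vanishes, and $\hat\gamma_k$ maps no non-empty open interval into a hyperplane of $\mathbb R^k$ through the origin. Let $F:B^1\to B^0$, $F(u)(t)=u'(t)+f(u(t))$, where either $B^1=C^1(\mathbb S^1)$ and $B^0=C^0(\mathbb S^1)$, or $B^1=H^1(\mathbb S^1)$ (absolutely continuous functions on $\mathbb S^1$ with derivative in $L^2$) and $B^0=L^2(\mathbb S^1)$; all functions are real valued. Let $\tilde B^0=\{v\in B^0:\int_{\mathbb S^1}v=0\}$. Then, in each of the two cases: 1. If $0$ lies in the interior of the convex hull of $\hat\gamma_2(\mathbb R)\subset\mathbb R^2$, then $F$ has a cusp, i.e. a Morin singularity of order $2$: there are $u\in B^1$, a Banach space $X$, $C^\infty$ diffeomorphisms $e_1$ from a neighbourhood of $u$ in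 $B^1$ and $e_0$ from a neighbourhood of $F(u)$ in $B^0$ onto open subsets of $X\times\mathbb R$, and a $C^\infty$ function $\mu$ with $(e_0\circ F\circ e_1^{-1})(x,y)=(x,\mu(x,y))$ on the whole image of $e_1$, such that at the point $e_1(u)$ one has $\partial_y\mu=\partial_y^2\mu=0$, $\partial_y^3\mu\neq0$ and $D(\partial_y\mu)\neq0$. 2. Otherwise $F$ is a (differentiable) global fold: there are $C^\infty$ diffeomorphisms $\Xi_1:B^1\to\mathbb R\times\tilde B^0$ and $\Xi_0:B^0\to\mathbb R\times\tilde B^0$ such that $(\Xi_0\circ F\circ\Xi_1^{-1})(x,\tilde v)=(x^2,\tilde v)$ for all $(x,\tilde v)\in\mathbb R\times\tilde B^0$. -/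

import Mathlib

open MeasureTheory Set Filter
open scoped ContDiff

noncomputable section

namespace PeriodicODE

/-! ### Morin singularities and global folds of maps between normed spaces -/

/-- `z` is a Morin singularity of order `k ≥ 1` of `G : E → F`: after smooth local changes of
variables `e₁` near `z` and `e₀` near `G z`, the map takes the adapted form
`(x, y) ↦ (x, μ (x, y))` on an open subset of `X × ℝ`, with `X` a Banach space, and at the point
`(x₀, y₀)` corresponding to `z` one has
(a) `∂μ/∂y = ⋯ = ∂ᵏμ/∂yᵏ = 0`,
(b) `∂ᵏ⁺¹μ/∂yᵏ⁺¹ ≠ 0`,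
(c) the derivative of `(∂μ/∂y, …, ∂ᵏ⁻¹μ/∂yᵏ⁻¹) : X × ℝ → ℝᵏ⁻¹` is surjective. -/
def IsMorinSingularity {E F : Type} [NormedAddCommGroup E] [NormedSpace ℝ E]
    [NormedAddCommGroup F] [NormedSpace ℝ F] (k : ℕ) (G : E → F) (z : E) : Prop :=
  ∃ (X : Type) (_ : NormedAddCommGroup X) (_ : NormedSpace ℝ X) (_ : CompleteSpace X)
    (e₁ : OpenPartialHomeomorph E (X × ℝ)) (e₀ : OpenPartialHomeomorph F (X × ℝ))
    (μ : X × ℝ → ℝ),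
    (z ∈ e₁.source ∧ ContDiffOn ℝ ∞ e₁ e₁.source ∧ ContDiffOn ℝ ∞ e₁.symm e₁.target) ∧
    (G z ∈ e₀.source ∧ ContDiffOn ℝ ∞ e₀ e₀.source ∧ ContDiffOn ℝ ∞ e₀.symm e₀.target) ∧
    MapsTo G e₁.source e₀.source ∧
    ContDiffOn ℝ ∞ μ e₁.target ∧
    (∀ p ∈ e₁.target, e₀ (G (e₁.symm p)) = (p.1, μ p)) ∧
    (∀ i : ℕ, 1 ≤ i → i ≤ k → iteratedDeriv i (fun y => μ ((e₁ z).1, y)) (e₁ z).2 = 0) ∧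
    iteratedDeriv (k + 1) (fun y => μ ((e₁ z).1, y)) (e₁ z).2 ≠ 0 ∧
    Function.Surjective
      (fderiv ℝ (fun (p : X × ℝ) (i : Fin (k - 1)) =>
        iteratedDeriv (i.val + 1) (fun y => μ (p.1, y)) p.2) (e₁ z))

/-- A cusp is a Morin singularity of order two. -/
def IsCusp {E F : Type} [NormedAddCommGroup E] [NormedSpace ℝ E]
    [NormedAddCommGroup F] [NormedSpace ℝ F] (G : E → F) (z : E) : Prop :=
  IsMorinSingularity 2 G z

/-- `G : E → F` is a (differentiable) global fold, relative to a subspace `T` of `F`: there are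
global smooth diffeomorphisms `Ξ₁ : E → ℝ × T` and `Ξ₀ : F → ℝ × T` for which
`Ξ₀ ∘ G ∘ Ξ₁⁻¹` is `(x, v) ↦ (x ^ 2, v)`. -/
def IsGlobalFold {E F : Type} [NormedAddCommGroup E] [NormedSpace ℝ E]
    [NormedAddCommGroup F] [NormedSpace ℝ F] (T : Submodule ℝ F) (G : E → F) : Prop :=
  ∃ (Ξ₁ : E ≃ ℝ × T) (Ξ₀ : F ≃ ℝ × T),
    ContDiff ℝ ∞ Ξ₁ ∧ ContDiff ℝ ∞ Ξ₁.symm ∧ ContDiff ℝ ∞ Ξ₀ ∧ ContDiff ℝ ∞ Ξ₀.symm ∧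
    ∀ (x : ℝ) (v : T), Ξ₀ (G (Ξ₁.symm (x, v))) = (x ^ 2, v)

/-! ### The nonlinearity -/

/-- The curve `x ↦ (f'(x), …, f⁽ᵏ⁾(x))` in `ℝᵏ`. -/
def gammaHat (k : ℕ) (f : ℝ → ℝ) (x : ℝ) : Fin k → ℝ :=
  fun i => iteratedDeriv (i.val + 1) f x

/-- `f` is `k`-good: the curve `gammaHat k f` never vanishes, and it maps no (non-empty) open
interval into a hyperplane through the origin. -/
def IsGood (k : ℕ) (f : ℝ → ℝ) : Prop :=
  (∀ x, gammaHat k f x ≠ 0) ∧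
  ∀ a b : ℝ, a < b → ∀ P : Submodule ℝ (Fin k → ℝ), Module.finrank ℝ P + 1 = k →
    ¬ gammaHat k f '' Ioo a b ⊆ (P : Set (Fin k → ℝ))

/-! ### The `C` case: continuously differentiable functions on the circle `ℝ / ℤ` -/

/-- The Banach space of continuous functions on the circle (sup norm). -/
abbrev C0 : Type := C(UnitAddCircle, ℝ)

/-- The space of continuously differentiable functions on the circle, each stored as the pair
`(u, u')`; the norm is `max (‖u‖_∞) (‖u'‖_∞)`. -/
def C1 : Submodule ℝ (C0 × C0) where
  carrier := {p | ∀ t : ℝ, HasDerivAt (fun s : ℝ => p.1 (s : UnitAddCircle)) (p.2 t) t}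
  add_mem' := fun ha hb t => (ha t).add (hb t)
  zero_mem' := fun t => hasDerivAt_const t (0 : ℝ)
  smul_mem' := fun c _ ha t => (ha t).const_mul c

/-- The operator `u ↦ u' + f ∘ u` from `C¹` to `C⁰`. -/
def opC (f : C(ℝ, ℝ)) (u : C1) : C0 := u.1.2 + f.comp u.1.1

/-- The continuous functions of average zero. -/
def C0tilde : Submodule ℝ C0 where
  carrier := {v | ∫ t, v t = 0}
  add_mem' := by
    intro v w hv hw
    have hi : ∀ v : C0, Integrable (fun t => v t) := fun v =>
      v.continuous.integrable_of_hasCompactSupport (HasCompactSupport.of_compactSpace _)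
    simp only [mem_ofPred_eq, ContinuousMap.add_apply] at *
    rw [integral_add (hi v) (hi w), hv, hw, add_zero]
  zero_mem' := by simp
  smul_mem' := by
    intro c v hv
    simp only [mem_ofPred_eq, ContinuousMap.smul_apply, smul_eq_mul] at *
    rw [integral_const_mul, hv, mul_zero]

/-! ### The `H` case: the Sobolev space `H¹` of the circle -/

/-- The space `L²` of the circle. -/
abbrev H0 : Type := Lp ℝ 2 (volume : Measure UnitAddCircle)

lemma H0.integrable (g : H0) : Integrable (fun t => g t) :=
  (Lp.memLp g).integrable (by norm_num)

lemma H0.intervalIntegrable (g : H0) {t : ℝ} (ht : t ∈ Icc (0 : ℝ) 1) :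
    IntervalIntegrable (fun s : ℝ => g (s : UnitAddCircle)) volume 0 t := by
  have h := (UnitAddCircle.measurePreserving_mk 0).integrable_comp_of_integrable
    (H0.integrable g)
  rw [intervalIntegrable_iff_integrableOn_Ioc_of_le ht.1]
  refine IntegrableOn.mono_set (t := Ioc (0 : ℝ) (0 + 1)) h ?_
  exact Ioc_subset_Ioc_right (by linarith [ht.2])

lemma H0.integral_congr {g h : UnitAddCircle → ℝ} (hgh : g =ᵐ[volume] h) {t : ℝ}
    (ht : t ∈ Icc (0 : ℝ) 1) :
    ∫ s in (0 : ℝ)..t, g (s : UnitAddCircle) = ∫ s in (0 : ℝ)..t, h (s : UnitAddCircle) := by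
  have h1 := (UnitAddCircle.measurePreserving_mk 0).quasiMeasurePreserving.ae_eq_comp hgh
  rw [intervalIntegral.integral_of_le ht.1, intervalIntegral.integral_of_le ht.1]
  refine MeasureTheory.integral_congr_ae ?_
  refine ae_restrict_of_ae_restrict_of_subset (t := Ioc (0 : ℝ) (0 + 1)) ?_ h1
  exact Ioc_subset_Ioc_right (by linarith [ht.2])

/-- The pairs `(u, u')` with `u` an absolutely continuous function on the circle and `u'` its
almost everywhere derivative, assumed to be in `L²`; absolute continuity is expressed by
`u(t) = u(0) + ∫₀ᵗ u'` for `0 ≤ t ≤ 1`. -/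
def H1pairs : Submodule ℝ (C0 × H0) where
  carrier := {p | ∀ t ∈ Icc (0 : ℝ) 1,
    p.1 (t : UnitAddCircle) = p.1 ((0 : ℝ) : UnitAddCircle)
      + ∫ s in (0 : ℝ)..t, p.2 (s : UnitAddCircle)}
  add_mem' := by
    intro p q hp hq t ht
    have h := H0.integral_congr (Lp.coeFn_add p.2 q.2) ht
    simp only [Pi.add_apply] at h
    rw [intervalIntegral.integral_add (H0.intervalIntegrable _ ht)
      (H0.intervalIntegrable _ ht)] at h
    simp only [Prod.fst_add, Prod.snd_add, ContinuousMap.add_apply]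
    rw [h, hp t ht, hq t ht]
    ring
  zero_mem' := by
    intro t ht
    have h := H0.integral_congr (Lp.coeFn_zero ℝ 2 (volume : Measure UnitAddCircle)) ht
    simp only [Prod.fst_zero, Prod.snd_zero, ContinuousMap.zero_apply]
    rw [h]
    simp
  smul_mem' := by
    intro c p hp t ht
    have h := H0.integral_congr (Lp.coeFn_smul c p.2) ht
    simp only [Pi.smul_apply, smul_eq_mul] at h
    rw [intervalIntegral.integral_const_mul] at h
    simp only [Prod.smul_fst, Prod.smul_snd, ContinuousMap.smul_apply, smul_eq_mul]
    rw [h, hp t ht]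
    ring

/-- The Sobolev space `H¹` of the circle; its norm is introduced below. -/
def H1 : Type := H1pairs

instance : AddCommGroup H1 := inferInstanceAs (AddCommGroup H1pairs)

instance : Module ℝ H1 := inferInstanceAs (Module ℝ H1pairs)

/-- The function underlying an element of `H¹`. -/
def H1.fn (u : H1) : C0 := u.1.1

/-- The derivative of an element of `H¹`. -/
def H1.der (u : H1) : H0 := u.1.2

/-- The inclusion `C⁰ → L²`. -/
def toH0 : C0 →ₗ[ℝ] H0 :=
  (ContinuousMap.toLp (E := ℝ) 2 (volume : Measure UnitAddCircle) ℝ).toLinearMap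

/-- The map `u ↦ (u, u')` from `H¹` to the Hilbert sum `L² ⊕ L²`. -/
def H1.toL2 : H1 →ₗ[ℝ] WithLp 2 (H0 × H0) where
  toFun u := WithLp.toLp 2 (toH0 u.fn, u.der)
  map_add' u v := by
    have h1 : (u + v).fn = u.fn + v.fn := rfl
    have h2 : (u + v).der = u.der + v.der := rfl
    rw [h1, h2, map_add]
    rfl
  map_smul' c u := by
    have h1 : (c • u).fn = c • u.fn := rfl
    have h2 : (c • u).der = c • u.der := rfl
    rw [h1, h2, map_smul]
    rfl

lemma H1.toL2_injective : Function.Injective H1.toL2 := by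
  intro u v h
  have h' : (toH0 u.fn, u.der) = (toH0 v.fn, v.der) := congrArg WithLp.ofLp h
  have h1 : u.fn = v.fn :=
    ContinuousMap.toLp_injective (E := ℝ) (p := 2) (𝕜 := ℝ)
      (volume : Measure UnitAddCircle) ((Prod.ext_iff.mp h').1)
  have h2 : u.der = v.der := (Prod.ext_iff.mp h').2
  exact Subtype.ext (Prod.ext h1 h2)

/-- The Hilbert norm `‖u‖² = ‖u‖²_{L²} + ‖u'‖²_{L²}` on `H¹`. -/
instance : NormedAddCommGroup H1 :=
  NormedAddCommGroup.induced H1 (WithLp 2 (H0 × H0)) H1.toL2 H1.toL2_injective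

instance : NormedSpace ℝ H1 := NormedSpace.induced ℝ H1 (WithLp 2 (H0 × H0)) H1.toL2

/-- The operator `u ↦ u' + f ∘ u` from `H¹` to `L²`. -/
def opH (f : C(ℝ, ℝ)) (u : H1) : H0 := u.der + toH0 (f.comp u.fn)

/-- The elements of `L²` of average zero. -/
def H0tilde : Submodule ℝ H0 where
  carrier := {v | ∫ t, v t = 0}
  add_mem' := by
    intro v w hv hw
    simp only [mem_ofPred_eq] at *
    rw [integral_congr_ae (Lp.coeFn_add v w)]
    simp only [Pi.add_apply]
    rw [integral_add (H0.integrable v) (H0.integrable w), hv, hw, add_zero]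
  zero_mem' := by
    simp only [mem_ofPred_eq]
    rw [integral_congr_ae (Lp.coeFn_zero ℝ 2 (volume : Measure UnitAddCircle))]
    simp
  smul_mem' := by
    intro c v hv
    simp only [mem_ofPred_eq] at *
    rw [integral_congr_ae (Lp.coeFn_smul c v)]
    simp only [Pi.smul_apply, smul_eq_mul]
    rw [integral_const_mul, hv, mul_zero]

end PeriodicODE

end

/-!
A function `u` on the circle is determined by `u(0)` and `u'`, and `F u = u' + f ∘ u` by its average
and its projection `v` to average zero. Integrating from `0`, the conditions that `u(0) = y` and
that `F u` projects to `v` become `u + prim (f ∘ u) = y + prim v`, which has a unique solution,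
smooth in `(y, v)`. In the coordinates `(u(0), v)` the map `F` is therefore `(y, v) ↦ (h (y, v),
v)`, where `h` is the average of `f ∘ u`, and `h` tends to infinity at both ends of each vertical
line. As `∂h/∂y` has the sign of `exp (∫ f' ∘ u) - 1`, the singularities are the `u` with `∫ f' ∘ u
= 0`.

If `0` is not interior to the convex hull of the curve `(f', f'')`, some combination `a f' + b f''`
with `b > 0` is nonnegative. At a zero of `∂h/∂y` the function `f' ∘ u` is orthogonal to `w = ∂u/∂y
> 0`, and `∂²h/∂y²` has the sign of `∫ (f'' ∘ u) w`, which is therefore positive. So each `h (·, v)`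
has a single critical point, a nondegenerate minimum, and `h` becomes `x ^ 2` after a global change
of variables in the source and subtraction of the minimum in the target.

If `0` is interior to the convex hull, there are a function `U` and a positive density `ρ` on the
circle with `f' ∘ U` and `f'' ∘ U` orthogonal to `ρ`, and, since `f` is `3`-good, with `f''' ∘ U`
not orthogonal to `ρ`. A reparametrization `u` of `U` makes `w` proportional to `ρ` in the new
variable, so that `∂h/∂y = ∂²h/∂y² = 0` and `∂³h/∂y³ ≠ 0` at `u`; and `∂h/∂y` has a nonzero
differential there because `f'' ∘ u` does not vanish identically.
-/

namespace PeriodicODE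

open scoped Topology

/-! ### Smooth superposition operators and global inverses -/

section Superposition

universe u

variable {K : Type*} {X Y : Type u} [TopologicalSpace K] [CompactSpace K]
  [NormedAddCommGroup X] [NormedSpace ℝ X] [NormedAddCommGroup Y] [NormedSpace ℝ Y]

/-- Pointwise application of a family of operators to a family of vectors; the derivative of a
superposition operator has this form. -/
noncomputable def pointwiseApply : C(K, X →L[ℝ] Y) →L[ℝ] C(K, X) →L[ℝ] C(K, Y) :=
  LinearMap.mkContinuous₂
    (LinearMap.mk₂ ℝ (fun (A : C(K, X →L[ℝ] Y)) (u : C(K, X)) =>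
        (⟨fun s => A s (u s), A.continuous.clm_apply u.continuous⟩ : C(K, Y)))
      (fun _ _ _ => by ext; simp) (fun _ _ _ => by ext; simp)
      (fun _ _ _ => by ext; simp) (fun _ _ _ => by ext; simp)) 1 fun A u => by
    rw [one_mul]
    refine (ContinuousMap.norm_le _ (by positivity)).mpr fun s => ?_
    exact (A s).le_of_opNorm_le_of_le (A.norm_coe_le_norm s) (u.norm_coe_le_norm s)

lemma hasFDerivAt_superposition {φ : C(X, Y)} {φ' : C(X, X →L[ℝ] Y)}
    (hφ : ∀ x, HasFDerivAt φ (φ' x) x) (u : C(K, X)) :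
    HasFDerivAt (fun v : C(K, X) => φ.comp v) (pointwiseApply (φ'.comp u)) u := by
  rw [hasFDerivAt_iff_isLittleO_nhds_zero, Asymptotics.isLittleO_iff]
  intro ε hε
  obtain ⟨δ, hδ, hφ'δ⟩ := (Metric.continuous_iff (α := C(K, X)) (β := C(K, X →L[ℝ] Y))).mp
    φ'.continuous_postcomp u ε hε
  have hball : ∀ s, ∀ x ∈ Metric.ball (u s) δ, ‖φ' x - φ' (u s)‖ ≤ ε := by
    intro s x hx
    have hclose : dist (u + ContinuousMap.const K (x - u s)) u < δ :=
      (ContinuousMap.dist_lt_iff hδ).mpr fun _ => by simpa [dist_eq_norm] using hx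
    simpa [dist_eq_norm] using (ContinuousMap.dist_apply_le_dist s).trans (hφ'δ _ hclose).le
  filter_upwards [Metric.ball_mem_nhds (0 : C(K, X)) hδ] with w hw
  refine (ContinuousMap.norm_le _ (by positivity)).mpr fun s => ?_
  have hws : ‖w s‖ < δ := (w.norm_coe_le_norm s).trans_lt (mem_ball_zero_iff.mp hw)
  have hmean : ‖φ (u s + w s) - φ (u s) - φ' (u s) (w s)‖ ≤ ε * ‖w s‖ := by
    simpa using (convex_ball (u s) δ).norm_image_sub_le_of_norm_hasFDerivWithin_le'
      (fun x _ => (hφ x).hasFDerivWithinAt) (hball s) (Metric.mem_ball_self hδ)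
      (y := u s + w s) (by simpa using hws)
  exact hmean.trans (by gcongr; exact w.norm_coe_le_norm s)

lemma contDiff_superposition {φ : C(X, Y)} (hφ : ContDiff ℝ ∞ φ) :
    ContDiff ℝ ∞ fun v : C(K, X) => φ.comp v := by
  rw [contDiff_infty]
  intro n
  induction n generalizing Y with
  | zero => exact contDiff_zero.mpr φ.continuous_postcomp
  | succ n ih =>
    obtain ⟨hdiff, hsmooth⟩ := contDiff_infty_iff_fderiv.mp hφ
    let φ' : C(X, X →L[ℝ] Y) := ⟨fderiv ℝ φ, hsmooth.continuous⟩
    refine (contDiff_succ_iff_hasFDerivAt (n := n)).mpr ⟨_, ?_,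
      hasFDerivAt_superposition (φ' := φ') fun x => (hdiff x).hasFDerivAt⟩
    exact pointwiseApply.contDiff.comp (ih (φ := φ') hsmooth)

end Superposition

lemma contDiff_symm_of_hasFDerivAt {E F : Type*} [NormedAddCommGroup E] [NormedSpace ℝ E]
    [CompleteSpace E] [NormedAddCommGroup F] [NormedSpace ℝ F] (Φ : E ≃ F)
    (hΦ : ContDiff ℝ ∞ Φ) (hd : ∀ x, ∃ A : E ≃L[ℝ] F, HasFDerivAt Φ (A : E →L[ℝ] F) x) :
    ContDiff ℝ ∞ Φ.symm := by
  choose A hA using hd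
  have ho : IsOpenMap Φ := isOpenMap_of_hasStrictFDerivAt_equiv fun x =>
    hΦ.contDiffAt.hasStrictFDerivAt' (hA x) (by simp)
  exact (Φ.toHomeomorphOfContinuousOpen hΦ.continuous ho).contDiff_symm hA hΦ

/-! ### Families of functions of one variable whose critical points are nondegenerate minima -/

lemma pos_of_deriv_pos_at_zeros {p p' : ℝ → ℝ} (hp : ∀ t, HasDerivAt p (p' t) t)
    (hz : ∀ t, p t = 0 → 0 < p' t) {a b : ℝ} (ha : 0 ≤ p a) (hab : a < b) : 0 < p b := by
  have hnn : ∀ t ∈ Icc a b, 0 ≤ p t := fun t ht => by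
    simpa using image_le_of_deriv_right_lt_deriv_boundary (f := fun t => -p t)
      (f' := fun t => -p' t) (B := fun _ => 0) (B' := fun _ => 0)
      (fun t _ => (hp t).neg.continuousAt.continuousWithinAt)
      (fun t _ => (hp t).neg.hasDerivWithinAt) (by simpa using ha)
      (fun t => hasDerivAt_const t 0)
      (fun t _ h0 => by simpa using hz t (by simpa using h0)) ht
  refine (hnn b ⟨hab.le, le_rfl⟩).lt_of_ne fun h0 => ?_
  have hneg : ∀ᶠ t in 𝓝[<] b, p t < 0 := by
    have hslope := (hasDerivAt_iff_tendsto_slope_left_right.mp (hp b)).1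
    filter_upwards [hslope.eventually (lt_mem_nhds (hz b h0.symm)), self_mem_nhdsWithin]
      with t ht htb
    rw [slope_def_field, ← h0, sub_zero] at ht
    exact (div_pos_iff.mp ht).elim (fun h => absurd h.2 (sub_neg.mpr htb).le.not_gt) And.left
  obtain ⟨t, ht, htab⟩ := (hneg.and (Ioo_mem_nhdsLT hab)).exists
  exact (hnn t ⟨htab.1.le, htab.2.le⟩).not_gt ht

lemma neg_of_deriv_pos_at_zeros {p p' : ℝ → ℝ} (hp : ∀ t, HasDerivAt p (p' t) t)
    (hz : ∀ t, p t = 0 → 0 < p' t) {a b : ℝ} (hb : p b ≤ 0) (hab : a < b) : p a < 0 := by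
  have := pos_of_deriv_pos_at_zeros (p := fun t => -p (-t)) (p' := fun t => p' (-t))
    (fun t => by simpa [Function.comp_def] using ((hp (-t)).scomp t (hasDerivAt_neg t)).fun_neg)
    (fun t h => hz _ (by simpa using h)) (a := -b) (b := -a) (by simpa using hb) (by linarith)
  simpa using this

section FoldNormalForm

variable {T : Type} [NormedAddCommGroup T] [NormedSpace ℝ T] {h : ℝ × T → ℝ}

/-- The partial derivative of a function on `ℝ × T` with respect to the real variable. -/
noncomputable def partialFst (h : ℝ × T → ℝ) (p : ℝ × T) : ℝ := fderiv ℝ h p (1, 0)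

lemma contDiff_partialFst (hh : ContDiff ℝ ∞ h) : ContDiff ℝ ∞ (partialFst h) :=
  (contDiff_infty_iff_fderiv.mp hh).2.clm_apply contDiff_const

lemma hasDerivAt_partialFst (hh : ContDiff ℝ ∞ h) (y : ℝ) (v : T) :
    HasDerivAt (fun y => h (y, v)) (partialFst h (y, v)) y :=
  (hh.differentiable (by simp) (y, v)).hasFDerivAt.comp_hasDerivAt y
    ((hasDerivAt_id y).prodMk (hasDerivAt_const y v))

lemma partialFst_eq {y d : ℝ} {v : T} (hh : ContDiff ℝ ∞ h)
    (hd : HasDerivAt (fun y => h (y, v)) d y) : partialFst h (y, v) = d :=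
  (hasDerivAt_partialFst hh y v).unique hd

/-- The linear automorphism `(a, b) ↦ (D (a, b), b)`. -/
noncomputable def shearEquiv (D : ℝ × T →L[ℝ] ℝ) (hD : D (1, 0) ≠ 0) : (ℝ × T) ≃L[ℝ] ℝ × T :=
  (ContinuousLinearEquiv.prodComm ℝ ℝ T).trans
    (((ContinuousLinearEquiv.refl ℝ T).skewProd
      (ContinuousLinearEquiv.unitsEquivAut ℝ (Units.mk0 _ hD))
      (D.comp (ContinuousLinearMap.inr ℝ ℝ T))).trans (ContinuousLinearEquiv.prodComm ℝ T ℝ))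

lemma coe_shearEquiv (D : ℝ × T →L[ℝ] ℝ) (hD : D (1, 0) ≠ 0) :
    (shearEquiv D hD : ℝ × T →L[ℝ] ℝ × T) = D.prod (ContinuousLinearMap.snd ℝ ℝ T) := by
  ext <;> simp [shearEquiv, ← Prod.zero_eq_mk]

lemma hasFDerivAt_shear (hh : ContDiff ℝ ∞ h) (p : ℝ × T) (hp : partialFst h p ≠ 0) :
    HasFDerivAt (fun p : ℝ × T => (h p, p.2))
      (shearEquiv (fderiv ℝ h p) hp : ℝ × T →L[ℝ] ℝ × T) p :=
  ((hh.differentiable (by simp) p).hasFDerivAt.prodMk hasFDerivAt_snd).congr_fderiv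
    (coe_shearEquiv _ hp).symm

/-- The segment from `(0, v)` to `(y, v)` as a continuous function on the unit interval. -/
noncomputable def horizontalSegment : ℝ × T →L[ℝ] C(unitInterval, ℝ × T) :=
  LinearMap.mkContinuous
    { toFun := fun p => ⟨fun s => ((s : ℝ) * p.1, p.2), by fun_prop⟩
      map_add' := fun p q => by ext s <;> simp [mul_add]
      map_smul' := fun c p => by ext s <;> simp [mul_left_comm] } 1 fun p => by
    rw [one_mul]
    refine (ContinuousMap.norm_le _ (norm_nonneg p)).mpr fun s => ?_
    refine max_le ?_ (norm_snd_le p)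
    calc ‖(s : ℝ) * p.1‖ = s * ‖p.1‖ := by rw [norm_mul, Real.norm_of_nonneg s.2.1]
      _ ≤ ‖p.1‖ := mul_le_of_le_one_left (norm_nonneg _) s.2.2
      _ ≤ ‖p‖ := norm_fst_le p

/-- Integration over the unit interval, as a functional on continuous functions. -/
noncomputable def unitIntegral : C(unitInterval, ℝ) →L[ℝ] ℝ :=
  LinearMap.mkContinuous
    { toFun := fun u => ∫ s in (0 : ℝ)..1, u (projIcc 0 1 zero_le_one s)
      map_add' := fun u v => intervalIntegral.integral_add
        ((u.continuous.comp continuous_projIcc).intervalIntegrable _ _)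
        ((v.continuous.comp continuous_projIcc).intervalIntegrable _ _)
      map_smul' := fun c u => by simp } 1 fun u => by
    simpa using intervalIntegral.norm_integral_le_of_norm_le_const (a := (0 : ℝ)) (b := 1)
      (f := fun s => u (projIcc 0 1 zero_le_one s)) fun s _ => u.norm_coe_le_norm _

/-- Hadamard's lemma with parameters. -/
lemma exists_eq_mul_of_eq_zero (hh : ContDiff ℝ ∞ h) (h0 : ∀ v, h (0, v) = 0) :
    ∃ g : ℝ × T → ℝ, ContDiff ℝ ∞ g ∧ (∀ y v, h (y, v) = y * g (y, v)) ∧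
      ∀ v, g (0, v) = partialFst h (0, v) := by
  have hd := contDiff_partialFst hh
  let h' : C(ℝ × T, ℝ) := ⟨partialFst h, hd.continuous⟩
  refine ⟨fun p => unitIntegral (h'.comp (horizontalSegment p)),
    unitIntegral.contDiff.comp ((contDiff_superposition hd).comp
      (horizontalSegment (T := T)).contDiff), fun y v => ?_,
    fun v => by simp [h', unitIntegral, horizontalSegment]⟩
  have hderiv : ∀ s ∈ uIcc (0 : ℝ) 1,
      HasDerivAt (fun s => h (s * y, v)) (y * partialFst h (s * y, v)) s := fun s _ => by
    simpa [Function.comp_def, mul_comm] using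
      (hasDerivAt_partialFst hh (s * y) v).comp s ((hasDerivAt_id s).mul_const y)
  have hcont : Continuous fun s : ℝ => y * partialFst h (s * y, v) :=
    continuous_const.mul (hd.continuous.comp (by fun_prop))
  have hftc := intervalIntegral.integral_eq_sub_of_hasDerivAt hderiv
    (hcont.intervalIntegrable _ _)
  rw [one_mul, zero_mul, h0, sub_zero, intervalIntegral.integral_const_mul] at hftc
  rw [← hftc]
  congr 1
  refine intervalIntegral.integral_congr fun s hs => ?_
  rw [uIcc_of_le zero_le_one] at hs
  simp [h', horizontalSegment, projIcc_of_mem zero_le_one hs]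

/-- Two applications of Hadamard's lemma write `h (y, v)` as `y ^ 2 * k (y, v)`, and `k` is
positive. -/
lemma exists_eq_sq_of_nondegenerate_zero (hh : ContDiff ℝ ∞ h) (h0 : ∀ v, h (0, v) = 0)
    (hpos : ∀ y v, y ≠ 0 → 0 < h (y, v)) (hd0 : ∀ v, 0 < partialFst (partialFst h) (0, v)) :
    ∃ r : ℝ × T → ℝ, ContDiff ℝ ∞ r ∧ (∀ p, 0 < r p) ∧ ∀ y v, h (y, v) = (y * r (y, v)) ^ 2 := by
  have hcrit : ∀ v, partialFst h (0, v) = 0 := fun v =>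
    IsLocalMin.hasDerivAt_eq_zero (Eventually.of_forall fun y => by
      rcases eq_or_ne y 0 with rfl | hy
      · exact le_rfl
      · exact (h0 v).le.trans (hpos y v hy).le) (hasDerivAt_partialFst hh 0 v)
  obtain ⟨h₁, hh₁, h_eq, h₁_zero⟩ := exists_eq_mul_of_eq_zero hh h0
  obtain ⟨h₂, hh₂, h₁_eq, h₂_zero⟩ :=
    exists_eq_mul_of_eq_zero hh₁ fun v => (h₁_zero v).trans (hcrit v)
  have hd1 : ∀ y v, partialFst h (y, v) = h₁ (y, v) + y * partialFst h₁ (y, v) := fun y v => by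
    refine partialFst_eq hh ?_
    simpa [h_eq] using (hasDerivAt_id y).fun_mul (hasDerivAt_partialFst hh₁ y v)
  have hd2 : ∀ v, partialFst (partialFst h) (0, v) = 2 * h₂ (0, v) := fun v => by
    refine partialFst_eq (contDiff_partialFst hh) ?_
    simp_rw [hd1]
    refine ((hasDerivAt_partialFst hh₁ 0 v).fun_add ((hasDerivAt_id (0 : ℝ)).fun_mul
      (hasDerivAt_partialFst (contDiff_partialFst hh₁) 0 v))).congr_deriv ?_
    simp [h₂_zero, two_mul]
  have h₂_pos : ∀ p, 0 < h₂ p := by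
    rintro ⟨y, v⟩
    rcases eq_or_ne y 0 with rfl | hy
    · linarith [hd0 v, hd2 v]
    · have hsq := hpos y v hy
      rw [h_eq, h₁_eq, ← mul_assoc] at hsq
      exact pos_of_mul_pos_right hsq (mul_self_nonneg y)
  refine ⟨fun p => √(h₂ p), hh₂.sqrt fun p => (h₂_pos p).ne', fun p => Real.sqrt_pos.mpr (h₂_pos p),
    fun y v => ?_⟩
  rw [h_eq, h₁_eq, mul_pow, Real.sq_sqrt (h₂_pos _).le]
  ring

variable [CompleteSpace T]

lemma contDiff_of_unique_zero (hh : ContDiff ℝ ∞ h) {c : T → ℝ}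
    (hc : ∀ y v, h (y, v) = 0 ↔ y = c v) (hd : ∀ v, partialFst h (c v, v) ≠ 0) :
    ContDiff ℝ ∞ c := by
  refine contDiff_iff_contDiffAt.mpr fun v => ?_
  let swap := ContinuousLinearEquiv.prodComm ℝ T ℝ
  have hsmooth : ContDiffAt ℝ ∞ (h ∘ swap) (v, c v) := (hh.comp swap.contDiff).contDiffAt
  have hinv : (fderiv ℝ (h ∘ swap) (v, c v) ∘L .inr ℝ T ℝ).IsInvertible := by
    refine ⟨ContinuousLinearEquiv.unitsEquivAut ℝ (Units.mk0 _ (hd v)), ?_⟩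
    ext
    simp [swap.comp_right_fderiv, swap, partialFst]
  refine (hsmooth.contDiffAt_implicitFunction (by simp) hinv).congr_of_eventuallyEq ?_
  filter_upwards [hsmooth.eventually_apply_implicitFunction (by simp) hinv] with w hw
  exact ((hc _ _).mp (hw.trans ((hc _ _).mpr rfl))).symm

lemma exists_equiv_of_partialFst_pos {X : ℝ × T → ℝ} (hX : ContDiff ℝ ∞ X)
    (hd : ∀ p, 0 < partialFst X p) (hsurj : ∀ v, Function.Surjective fun y => X (y, v)) :
    ∃ Θ : ℝ × T ≃ ℝ × T, ContDiff ℝ ∞ Θ ∧ ContDiff ℝ ∞ Θ.symm ∧ ∀ p, Θ p = (X p, p.2) := by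
  have hmono : ∀ v, StrictMono fun y => X (y, v) := fun v =>
    strictMono_of_hasDerivAt_pos (fun y => hasDerivAt_partialFst hX y v) fun y => hd _
  have hbij : Function.Bijective fun p : ℝ × T => (X p, p.2) := by
    refine ⟨?_, fun ⟨x, v⟩ => ?_⟩
    · rintro ⟨y, v⟩ ⟨y', v'⟩ hE
      obtain ⟨hXE, rfl⟩ : X (y, v) = X (y', v') ∧ v = v' := Prod.mk.inj hE
      rw [(hmono v).injective hXE]
    · obtain ⟨y, hy⟩ := hsurj v x
      exact ⟨(y, v), Prod.ext hy rfl⟩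
  have hΘ : ContDiff ℝ ∞ (Equiv.ofBijective _ hbij) := hX.prodMk contDiff_snd
  exact ⟨Equiv.ofBijective _ hbij, hΘ, contDiff_symm_of_hasFDerivAt _ hΘ fun p =>
    ⟨_, hasFDerivAt_shear hX p (hd p).ne'⟩, fun _ => rfl⟩

lemma exists_equiv_sq (hh : ContDiff ℝ ∞ h) (h0 : ∀ v, h (0, v) = 0)
    (hpos : ∀ y v, y ≠ 0 → 0 < h (y, v)) (hsign : ∀ y v, y ≠ 0 → 0 < y * partialFst h (y, v))
    (hd0 : ∀ v, 0 < partialFst (partialFst h) (0, v))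
    (hlim : ∀ v, Tendsto (fun y => h (y, v)) (cocompact ℝ) atTop) :
    ∃ Θ : ℝ × T ≃ ℝ × T, ContDiff ℝ ∞ Θ ∧ ContDiff ℝ ∞ Θ.symm ∧
      ∀ p, (Θ p).1 ^ 2 = h p ∧ (Θ p).2 = p.2 := by
  obtain ⟨r, hr, hr_pos, h_eq⟩ := exists_eq_sq_of_nondegenerate_zero hh h0 hpos hd0
  let X : ℝ × T → ℝ := fun p => p.1 * r p
  have hX : ContDiff ℝ ∞ X := contDiff_fst.mul hr
  have hXr : ∀ y v, partialFst X (y, v) = r (y, v) + y * partialFst r (y, v) := fun y v =>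
    partialFst_eq hX (by simpa using (hasDerivAt_id y).fun_mul (hasDerivAt_partialFst hr y v))
  have hXh : ∀ y v, 2 * X (y, v) * partialFst X (y, v) = partialFst h (y, v) := fun y v =>
    (partialFst_eq hh (by simpa [h_eq] using (hasDerivAt_partialFst hX y v).fun_pow 2)).symm
  have hXd : ∀ p, 0 < partialFst X p := by
    rintro ⟨y, v⟩
    rcases eq_or_ne y 0 with rfl | hy
    · simpa [hXr] using hr_pos (0, v)
    · have hprod : 0 < 2 * (y ^ 2 * r (y, v)) * partialFst X (y, v) := by
        calc 0 < y * partialFst h (y, v) := hsign y v hy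
          _ = 2 * (y ^ 2 * r (y, v)) * partialFst X (y, v) := by rw [← hXh]; ring
      have := hr_pos (y, v)
      exact pos_of_mul_pos_right hprod (by positivity)
  have hsurj : ∀ v, Function.Surjective fun y => X (y, v) := fun v => by
    have hlim' := hlim v
    rw [cocompact_eq_atBot_atTop, tendsto_sup] at hlim'
    obtain ⟨hbot, htop⟩ := hlim'
    refine Continuous.surjective (hX.continuous.comp (by fun_prop)) ?_ ?_
    · refine (Real.tendsto_sqrt_atTop.comp htop).congr' ?_
      filter_upwards [eventually_ge_atTop 0] with y hy
      rw [Function.comp_apply, h_eq, Real.sqrt_sq (mul_nonneg hy (hr_pos _).le)]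
    · refine (tendsto_neg_atTop_atBot.comp (Real.tendsto_sqrt_atTop.comp hbot)).congr' ?_
      filter_upwards [eventually_le_atBot 0] with y hy
      rw [Function.comp_apply, Function.comp_apply, h_eq, ← neg_sq,
        Real.sqrt_sq (neg_nonneg.mpr (mul_nonpos_of_nonpos_of_nonneg hy (hr_pos _).le)), neg_neg]
  obtain ⟨Θ, hΘ, hΘs, hΘX⟩ := exists_equiv_of_partialFst_pos hX hXd hsurj
  exact ⟨Θ, hΘ, hΘs, fun p => by rw [hΘX]; exact ⟨(h_eq _ _).symm, rfl⟩⟩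

lemma exists_strict_minimizer (hh : ContDiff ℝ ∞ h)
    (hlim : ∀ v, Tendsto (fun y => h (y, v)) (cocompact ℝ) atTop)
    (hcrit : ∀ p, partialFst h p = 0 → 0 < partialFst (partialFst h) p) :
    ∃ c : T → ℝ, ContDiff ℝ ∞ c ∧ (∀ v, partialFst h (c v, v) = 0) ∧
      (∀ y v, y ≠ c v → h (c v, v) < h (y, v)) ∧
      ∀ y v, y ≠ c v → 0 < (y - c v) * partialFst h (y, v) := by
  have hd := contDiff_partialFst hh
  have hex : ∀ v, ∃ y, ∀ y', h (y, v) ≤ h (y', v) := fun v =>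
    (hh.continuous.comp (by fun_prop : Continuous fun y : ℝ => (y, v))).exists_forall_le (hlim v)
  choose c hc using hex
  have hmin : ∀ y v, (∀ y', h (y, v) ≤ h (y', v)) → partialFst h (y, v) = 0 := fun y v hy =>
    IsLocalMin.hasDerivAt_eq_zero (Eventually.of_forall hy) (hasDerivAt_partialFst hh y v)
  have hc0 : ∀ v, partialFst h (c v, v) = 0 := fun v => hmin _ _ (hc v)
  have hsign : ∀ y v, y ≠ c v → 0 < (y - c v) * partialFst h (y, v) := by
    intro y v hy
    have hderiv := fun y => hasDerivAt_partialFst hd y v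
    rcases hy.lt_or_gt with hy | hy
    · exact mul_pos_of_neg_of_neg (sub_neg.mpr hy)
        (neg_of_deriv_pos_at_zeros hderiv (fun y => hcrit (y, v)) (hc0 v).le hy)
    · exact mul_pos (sub_pos.mpr hy)
        (pos_of_deriv_pos_at_zeros hderiv (fun y => hcrit (y, v)) (hc0 v).ge hy)
  have hunique : ∀ y v, partialFst h (y, v) = 0 ↔ y = c v := fun y v =>
    ⟨fun h0 => by_contra fun hy => by simpa [h0] using hsign y v hy, fun hy => hy ▸ hc0 v⟩
  refine ⟨c, contDiff_of_unique_zero hd hunique fun v => (hcrit _ (hc0 v)).ne', hc0, ?_, hsign⟩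
  exact fun y v hy => (hc v y).lt_of_ne fun heq =>
    hy ((hunique y v).mp (hmin y v fun y' => heq ▸ hc v y'))

theorem exists_fold_normal_form (hh : ContDiff ℝ ∞ h)
    (hlim : ∀ v, Tendsto (fun y => h (y, v)) (cocompact ℝ) atTop)
    (hcrit : ∀ p, partialFst h p = 0 → 0 < partialFst (partialFst h) p) :
    ∃ (Θ : ℝ × T ≃ ℝ × T) (b : T → ℝ), ContDiff ℝ ∞ Θ ∧ ContDiff ℝ ∞ Θ.symm ∧ ContDiff ℝ ∞ b ∧
      ∀ p, h p = (Θ p).1 ^ 2 + b p.2 ∧ (Θ p).2 = p.2 := by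
  obtain ⟨c, hc, hc0, hmin, hsign⟩ := exists_strict_minimizer hh hlim hcrit
  let e : ℝ × T ≃ ℝ × T :=
    { toFun := fun p => (-c p.2 + p.1, p.2)
      invFun := fun p => (c p.2 + p.1, p.2)
      left_inv := fun p => by simp
      right_inv := fun p => by simp }
  have he : ContDiff ℝ ∞ e := ((hc.comp contDiff_snd).neg.add contDiff_fst).prodMk contDiff_snd
  have hes : ContDiff ℝ ∞ e.symm := ((hc.comp contDiff_snd).add contDiff_fst).prodMk contDiff_snd
  let b : T → ℝ := fun v => h (c v, v)
  have hb : ContDiff ℝ ∞ b := hh.comp (hc.prodMk contDiff_id)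
  let k : ℝ × T → ℝ := fun p => h (e.symm p) - b p.2
  have hk : ContDiff ℝ ∞ k := (hh.comp hes).sub (hb.comp contDiff_snd)
  have hshift : ∀ {g : ℝ × T → ℝ}, ContDiff ℝ ∞ g → ∀ y v,
      HasDerivAt (fun y => g (c v + y, v)) (partialFst g (c v + y, v)) y := fun hg y v =>
    (hasDerivAt_partialFst hg (c v + y) v).comp_const_add (c v) y
  have hkd : ∀ y v, partialFst k (y, v) = partialFst h (c v + y, v) := fun y v =>
    partialFst_eq hk ((hshift hh y v).sub_const (b v))
  have hkdd : ∀ v, partialFst (partialFst k) (0, v) = partialFst (partialFst h) (c v, v) :=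
    fun v => partialFst_eq (contDiff_partialFst hk)
      (by simpa [hkd] using hshift (contDiff_partialFst hh) 0 v)
  obtain ⟨Θ, hΘ, hΘs, hΘk⟩ := exists_equiv_sq hk (fun v => by simp [k, e, b])
    (fun y v hy => sub_pos.mpr (hmin _ v (by simpa using hy)))
    (fun y v hy => by simpa [hkd] using hsign (c v + y) v (by simpa using hy))
    (fun v => hkdd v ▸ hcrit _ (hc0 v))
    (fun v => tendsto_atTop_add_const_right _ (-b v)
      ((hlim v).comp (Homeomorph.addLeft (c v)).isClosedEmbedding.tendsto_cocompact))
  refine ⟨e.trans Θ, b, hΘ.comp he, hes.comp hΘs, hb, fun p => ?_⟩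
  obtain ⟨hsq, hsnd⟩ := hΘk (e p)
  refine ⟨?_, hsnd⟩
  rw [Equiv.trans_apply, hsq]
  simp [k, e]

end FoldNormalForm

/-! ### Primitives on the circle -/

lemma exists_mem_Ico_coe (x : UnitAddCircle) : ∃ t ∈ Ico (0 : ℝ) 1, (t : UnitAddCircle) = x := by
  obtain ⟨t, ht, h⟩ := (AddCircle.coe_image_Ico_eq (1 : ℝ) 0).symm ▸ mem_univ x
  exact ⟨t, by simpa using ht, h⟩

lemma coe_one_circle : ((1 : ℝ) : UnitAddCircle) = ((0 : ℝ) : UnitAddCircle) := by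
  simp

lemma C0.ext_Icc {u v : C0} (h : ∀ t ∈ Icc (0 : ℝ) 1, u (t : UnitAddCircle) = v t) : u = v := by
  ext x
  obtain ⟨t, ht, rfl⟩ := exists_mem_Ico_coe x
  exact h t (Ico_subset_Icc_self ht)

lemma C0.continuous_coe (u : C0) : Continuous fun t : ℝ => u (t : UnitAddCircle) :=
  u.continuous.comp (AddCircle.continuous_mk' (1 : ℝ))

lemma C0.intervalIntegrable (u : C0) (a b : ℝ) :
    IntervalIntegrable (fun t : ℝ => u (t : UnitAddCircle)) volume a b :=
  u.continuous_coe.intervalIntegrable a b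

/-- The continuous function on the circle that restricts to a given function on `[0, 1]`. -/
noncomputable def liftUnit (F : ℝ → ℝ) (hF : ContinuousOn F (Icc 0 1)) (h01 : F 0 = F 1) : C0 :=
  ⟨AddCircle.liftIco 1 0 F, AddCircle.liftIco_zero_continuous h01 hF⟩

lemma liftUnit_apply {F : ℝ → ℝ} (hF : ContinuousOn F (Icc 0 1)) (h01 : F 0 = F 1) {t : ℝ}
    (ht : t ∈ Icc (0 : ℝ) 1) : liftUnit F hF h01 (t : UnitAddCircle) = F t := by
  rcases ht.2.lt_or_eq with h | rfl
  · exact AddCircle.liftIco_zero_coe_apply ⟨ht.1, h⟩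
  · rw [coe_one_circle, ← h01]
    exact AddCircle.liftIco_zero_coe_apply ⟨le_rfl, zero_lt_one⟩

lemma circle_integral_eq (g : UnitAddCircle → ℝ) :
    ∫ t, g t = ∫ s in (0 : ℝ)..1, g (s : UnitAddCircle) := by
  rw [← UnitAddCircle.intervalIntegral_preimage 0 g, zero_add]

lemma H0.integral_abs_le (g : H0) : ∫ t, |g t| ≤ ‖g‖ := by
  have hL1 : ∫ t, |g t| = (eLpNorm g 1 volume).toReal := by
    rw [eLpNorm_one_eq_lintegral_enorm, ← integral_norm_eq_lintegral_enorm (Lp.memLp g).1]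
    rfl
  have : IsProbabilityMeasure (volume : Measure UnitAddCircle) := ⟨UnitAddCircle.measure_univ⟩
  rw [hL1, Lp.norm_def]
  exact ENNReal.toReal_mono (Lp.memLp g).2.ne
    (eLpNorm_le_eLpNorm_of_exponent_le (by norm_num) (Lp.memLp g).1)

/-- The integral of an `L²` function. -/
noncomputable def meanH : H0 →L[ℝ] ℝ :=
  LinearMap.mkContinuous
    { toFun := fun g => ∫ t, g t
      map_add' := fun g h => by
        rw [integral_congr_ae (Lp.coeFn_add g h)]
        exact integral_add (H0.integrable g) (H0.integrable h)
      map_smul' := fun c g => by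
        rw [integral_congr_ae (Lp.coeFn_smul c g)]
        exact integral_const_mul c _ } 1 fun g => by
    rw [one_mul]
    exact abs_integral_le_integral_abs.trans (H0.integral_abs_le g)

lemma meanH_eq (g : H0) : meanH g = ∫ s in (0 : ℝ)..1, g (s : UnitAddCircle) :=
  circle_integral_eq _

lemma H0.abs_integral_le (g : H0) {t : ℝ} (ht : t ∈ Icc (0 : ℝ) 1) :
    |∫ s in (0 : ℝ)..t, g (s : UnitAddCircle)| ≤ ‖g‖ := by
  refine (intervalIntegral.abs_integral_le_integral_abs ht.1).trans ?_
  refine le_trans ?_ (H0.integral_abs_le g)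
  rw [circle_integral_eq fun t => |g t|]
  exact intervalIntegral.integral_mono_interval le_rfl ht.1 ht.2
    (Eventually.of_forall fun _ => abs_nonneg _)
    (H0.intervalIntegrable g ⟨zero_le_one, le_rfl⟩).abs

lemma H0.continuousOn_primitive (g : H0) :
    ContinuousOn (fun t : ℝ => ∫ s in (0 : ℝ)..t, g (s : UnitAddCircle)) (Icc 0 1) := by
  have h := intervalIntegral.continuousOn_primitive_interval'
    (H0.intervalIntegrable g ⟨zero_le_one, le_rfl⟩) (left_mem_uIcc)
  rwa [uIcc_of_le zero_le_one] at h

lemma H0.abs_primitive_sub_le (g : H0) {t : ℝ} (ht : t ∈ Icc (0 : ℝ) 1) :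
    |(∫ s in (0 : ℝ)..t, g (s : UnitAddCircle)) - t * meanH g| ≤ 2 * ‖g‖ := by
  have hmean : |meanH g| ≤ ‖g‖ := by
    rw [meanH_eq]
    exact H0.abs_integral_le g ⟨zero_le_one, le_rfl⟩
  calc _ ≤ |∫ s in (0 : ℝ)..t, g (s : UnitAddCircle)| + |t * meanH g| := abs_sub _ _
    _ ≤ ‖g‖ + ‖g‖ := by
      rw [abs_mul, abs_of_nonneg ht.1]
      exact add_le_add (H0.abs_integral_le g ht)
        ((mul_le_of_le_one_left (abs_nonneg _) ht.2).trans hmean)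
    _ = 2 * ‖g‖ := (two_mul _).symm

/-- The primitive, vanishing at `0`, of an `L²` function minus its average. -/
noncomputable def primH : H0 →L[ℝ] C0 :=
  LinearMap.mkContinuous
    { toFun := fun g => liftUnit
        (fun t => (∫ s in (0 : ℝ)..t, g (s : UnitAddCircle)) - t * meanH g)
        ((H0.continuousOn_primitive g).sub (by fun_prop)) (by simp [meanH_eq])
      map_add' := fun g h => C0.ext_Icc fun t ht => by
        have hadd := H0.integral_congr (Lp.coeFn_add g h) ht
        simp only [Pi.add_apply] at hadd
        rw [intervalIntegral.integral_add (H0.intervalIntegrable _ ht)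
          (H0.intervalIntegrable _ ht)] at hadd
        rw [ContinuousMap.add_apply, liftUnit_apply _ _ ht, liftUnit_apply _ _ ht,
          liftUnit_apply _ _ ht, hadd, map_add]
        ring
      map_smul' := fun c g => C0.ext_Icc fun t ht => by
        have hsmul := H0.integral_congr (Lp.coeFn_smul c g) ht
        simp only [Pi.smul_apply, smul_eq_mul] at hsmul
        rw [intervalIntegral.integral_const_mul] at hsmul
        rw [RingHom.id_apply, ContinuousMap.smul_apply, liftUnit_apply _ _ ht,
          liftUnit_apply _ _ ht, hsmul, map_smul, smul_eq_mul, smul_eq_mul]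
        ring } 2 fun g => by
    refine (ContinuousMap.norm_le _ (by positivity)).mpr fun x => ?_
    obtain ⟨t, ht, rfl⟩ := exists_mem_Ico_coe x
    replace ht := Ico_subset_Icc_self ht
    simp only [LinearMap.coe_mk, AddHom.coe_mk]
    rw [liftUnit_apply _ _ ht]
    exact H0.abs_primitive_sub_le g ht

lemma primH_apply (g : H0) {t : ℝ} (ht : t ∈ Icc (0 : ℝ) 1) :
    primH g (t : UnitAddCircle)
      = (∫ s in (0 : ℝ)..t, g (s : UnitAddCircle)) - t * meanH g :=
  liftUnit_apply (F := fun t => (∫ s in (0 : ℝ)..t, g (s : UnitAddCircle)) - t * meanH g)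
    ((H0.continuousOn_primitive g).sub (by fun_prop)) (by simp [meanH_eq]) ht

/-- The inclusion of `C⁰` in `L²` as a continuous linear map. -/
noncomputable def inclH : C0 →L[ℝ] H0 :=
  ContinuousMap.toLp (E := ℝ) 2 (volume : Measure UnitAddCircle) ℝ

lemma coeFn_inclH (u : C0) : (inclH u : UnitAddCircle → ℝ) =ᵐ[volume] u :=
  ContinuousMap.coeFn_toLp (p := 2) (𝕜 := ℝ) (volume : Measure UnitAddCircle) u

/-- The integral of a continuous function on the circle. -/
noncomputable def mean : C0 →L[ℝ] ℝ := meanH.comp inclH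

/-- The primitive, vanishing at `0`, of a continuous function minus its average. -/
noncomputable def prim : C0 →L[ℝ] C0 := primH.comp inclH

lemma mean_eq_integral (u : C0) : mean u = ∫ t, u t := integral_congr_ae (coeFn_inclH u)

lemma mean_eq (u : C0) : mean u = ∫ s in (0 : ℝ)..1, u (s : UnitAddCircle) :=
  (mean_eq_integral u).trans (circle_integral_eq _)

lemma prim_apply (u : C0) {t : ℝ} (ht : t ∈ Icc (0 : ℝ) 1) :
    prim u (t : UnitAddCircle) = (∫ s in (0 : ℝ)..t, u (s : UnitAddCircle)) - t * mean u := by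
  have h := primH_apply (inclH u) ht
  rwa [H0.integral_congr (coeFn_inclH u) ht] at h

lemma prim_zero (u : C0) : prim u ((0 : ℝ) : UnitAddCircle) = 0 := by
  rw [prim_apply u ⟨le_rfl, zero_le_one⟩]; simp

lemma primH_zero (u : H0) : primH u ((0 : ℝ) : UnitAddCircle) = 0 := by
  rw [primH_apply u ⟨le_rfl, zero_le_one⟩]; simp

lemma mean_one : mean 1 = 1 := by
  rw [mean_eq]; simp

lemma prim_one : prim 1 = 0 := C0.ext_Icc fun t ht => by
  rw [prim_apply _ ht, mean_one]; simp

lemma hasDerivAt_integral (u : C0) (t : ℝ) :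
    HasDerivAt (fun t : ℝ => ∫ s in (0 : ℝ)..t, u (s : UnitAddCircle)) (u (t : UnitAddCircle)) t :=
  intervalIntegral.integral_hasDerivAt_right (u.intervalIntegrable _ _)
    u.continuous_coe.stronglyMeasurable.stronglyMeasurableAtFilter u.continuous_coe.continuousAt

lemma prim_apply_real (u : C0) (t : ℝ) :
    prim u (t : UnitAddCircle) = (∫ s in (0 : ℝ)..t, u (s : UnitAddCircle)) - t * mean u := by
  have hper : Function.Periodic
      (fun t : ℝ => (∫ s in (0 : ℝ)..t, u (s : UnitAddCircle)) - t * mean u) 1 := by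
    intro t
    have hu : Function.Periodic (fun s : ℝ => u (s : UnitAddCircle)) 1 := fun s =>
      congrArg u (AddCircle.coe_add_period (1 : ℝ) s)
    have hsplit := hu.intervalIntegral_add_eq_add 0 t fun a b => u.intervalIntegrable a b
    rw [zero_add, ← mean_eq] at hsplit
    simp only [hsplit]
    ring
  obtain ⟨s, hs, hst⟩ := exists_mem_Ico_coe (t : UnitAddCircle)
  rw [← hst, prim_apply u (Ico_subset_Icc_self hs), ← hper.lift_coe s, hst, hper.lift_coe]

lemma hasDerivAt_prim (u : C0) (t : ℝ) :
    HasDerivAt (fun t : ℝ => prim u (t : UnitAddCircle)) (u (t : UnitAddCircle) - mean u) t := by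
  simp_rw [prim_apply_real]
  simpa using (hasDerivAt_integral u t).fun_sub ((hasDerivAt_id t).mul_const (mean u))

lemma eq_const_add_prim {u u' : C0} (h : ∀ t ∈ Ioo (0 : ℝ) 1,
      HasDerivAt (fun s : ℝ => u (s : UnitAddCircle)) (u' (t : UnitAddCircle)) t) :
    u = ContinuousMap.const _ (u ((0 : ℝ) : UnitAddCircle)) + prim u' ∧ mean u' = 0 := by
  have hint : ∀ t ∈ Icc (0 : ℝ) 1, ∫ s in (0 : ℝ)..t, u' (s : UnitAddCircle)
      = u (t : UnitAddCircle) - u ((0 : ℝ) : UnitAddCircle) := fun t ht =>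
    intervalIntegral.integral_eq_sub_of_hasDerivAt_of_le ht.1 u.continuous_coe.continuousOn
      (fun s hs => h s ⟨hs.1, hs.2.trans_le ht.2⟩) (u'.intervalIntegrable _ _)
  have hmean : mean u' = 0 := by
    rw [mean_eq, hint 1 ⟨zero_le_one, le_rfl⟩, coe_one_circle, sub_self]
  refine ⟨C0.ext_Icc fun t ht => ?_, hmean⟩
  rw [ContinuousMap.add_apply, prim_apply _ ht, hint t ht, hmean]
  simp

/-! ### The linear equation `x + prim (q * x + r) = c` -/

/-- The integrating factor `exp (∫₀ᵗ q)` of the linear differential equation with coefficient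
`q`; it is a function on `ℝ`, as it is `1`-periodic only when `q` has average zero. -/
noncomputable def expInt (q : C0) (t : ℝ) : ℝ :=
  Real.exp (∫ s in (0 : ℝ)..t, q (s : UnitAddCircle))

lemma expInt_pos (q : C0) (t : ℝ) : 0 < expInt q t := Real.exp_pos _

lemma expInt_zero (q : C0) : expInt q 0 = 1 := by simp [expInt]

lemma expInt_one (q : C0) : expInt q 1 = Real.exp (mean q) := by rw [expInt, mean_eq]

lemma hasDerivAt_expInt (q : C0) (t : ℝ) :
    HasDerivAt (expInt q) (q (t : UnitAddCircle) * expInt q t) t := by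
  rw [mul_comm]
  exact (hasDerivAt_integral q t).exp

lemma continuous_expInt (q : C0) : Continuous (expInt q) :=
  continuous_iff_continuousAt.mpr fun t => (hasDerivAt_expInt q t).continuousAt

lemma integral_expInt_pos (q : C0) : 0 < ∫ s in (0 : ℝ)..1, expInt q s :=
  intervalIntegral.intervalIntegral_pos_of_pos ((continuous_expInt q).intervalIntegrable _ _)
    (expInt_pos q) zero_lt_one

lemma integral_const_sub_mul_expInt (q r : C0) (κ : ℝ) :
    ∫ s in (0 : ℝ)..1, (κ - r (s : UnitAddCircle)) * expInt q s
      = κ * (∫ s in (0 : ℝ)..1, expInt q s)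
        - ∫ s in (0 : ℝ)..1, r (s : UnitAddCircle) * expInt q s := by
  have hκ : IntervalIntegrable (fun s => κ * expInt q s) volume 0 1 :=
    (continuous_const.mul (continuous_expInt q)).intervalIntegrable _ _
  have hr : IntervalIntegrable (fun s : ℝ => r (s : UnitAddCircle) * expInt q s) volume 0 1 :=
    (r.continuous_coe.mul (continuous_expInt q)).intervalIntegrable _ _
  simp_rw [sub_mul]
  rw [intervalIntegral.integral_sub hκ hr, intervalIntegral.integral_const_mul]

lemma C0.abs_le (u : C0) (x : UnitAddCircle) : |u x| ≤ ‖u‖ := u.norm_coe_le_norm x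

lemma abs_integral_le_norm (q : C0) {t : ℝ} (ht : t ∈ Icc (0 : ℝ) 1) :
    |∫ s in (0 : ℝ)..t, q (s : UnitAddCircle)| ≤ ‖q‖ := by
  have h := intervalIntegral.norm_integral_le_of_norm_le_const (a := (0 : ℝ)) (b := t)
    (f := fun s : ℝ => q (s : UnitAddCircle)) (C := ‖q‖) fun s _ => q.norm_coe_le_norm _
  rw [sub_zero, abs_of_nonneg ht.1, Real.norm_eq_abs] at h
  exact h.trans (mul_le_of_le_one_right (norm_nonneg _) ht.2)

lemma expInt_le (q : C0) {t : ℝ} (ht : t ∈ Icc (0 : ℝ) 1) : expInt q t ≤ Real.exp ‖q‖ :=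
  Real.exp_le_exp.mpr ((le_abs_self _).trans (abs_integral_le_norm q ht))

lemma exp_neg_norm_le_expInt (q : C0) {t : ℝ} (ht : t ∈ Icc (0 : ℝ) 1) :
    Real.exp (-‖q‖) ≤ expInt q t :=
  Real.exp_le_exp.mpr (neg_le_of_abs_le (abs_integral_le_norm q ht))

lemma abs_integral_mul_expInt_le (q w : C0) {t : ℝ} (ht : 0 ≤ t) :
    |∫ s in (0 : ℝ)..t, w (s : UnitAddCircle) * expInt q s|
      ≤ ‖w‖ * ∫ s in (0 : ℝ)..t, expInt q s := by
  have hi : IntervalIntegrable (fun s => ‖w‖ * expInt q s) volume 0 t :=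
    (continuous_const.mul (continuous_expInt q)).intervalIntegrable _ _
  rw [← intervalIntegral.integral_const_mul, ← Real.norm_eq_abs]
  refine intervalIntegral.norm_integral_le_of_norm_le ht (Eventually.of_forall fun s _ => ?_) hi
  rw [norm_mul, Real.norm_of_nonneg (expInt_pos q s).le]
  exact mul_le_mul_of_nonneg_right (w.abs_le _) (expInt_pos q s).le

lemma integral_expInt_le (q : C0) {t : ℝ} (ht : t ∈ Icc (0 : ℝ) 1) :
    ∫ s in (0 : ℝ)..t, expInt q s ≤ Real.exp ‖q‖ :=
  calc ∫ s in (0 : ℝ)..t, expInt q s ≤ ∫ _ in (0 : ℝ)..t, Real.exp ‖q‖ :=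
        intervalIntegral.integral_mono_on ht.1 ((continuous_expInt q).intervalIntegrable _ _)
          intervalIntegrable_const fun s hs => expInt_le q ⟨hs.1, hs.2.trans ht.2⟩
    _ ≤ Real.exp ‖q‖ := by
      rw [intervalIntegral.integral_const, sub_zero, smul_eq_mul]
      exact mul_le_of_le_one_left (Real.exp_pos _).le ht.2

section Solution

variable {q r x : C0} {c : ℝ}

/-- The equation says that `x' + q x + r` is constant and that `x 0 = c`. -/
lemma mul_expInt_eq (hx : x + prim (q * x + r) = ContinuousMap.const _ c) (t : ℝ) :
    x (t : UnitAddCircle) * expInt q t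
      = c + ∫ s in (0 : ℝ)..t, (mean (q * x + r) - r (s : UnitAddCircle)) * expInt q s := by
  set κ := mean (q * x + r) with hκ
  have hxt : ∀ t : ℝ, x (t : UnitAddCircle) = c - prim (q * x + r) (t : UnitAddCircle) :=
    fun t => eq_sub_of_add_eq (DFunLike.congr_fun hx _)
  have hderiv : ∀ t : ℝ, HasDerivAt (fun t : ℝ => x (t : UnitAddCircle))
      (κ - q (t : UnitAddCircle) * x (t : UnitAddCircle) - r (t : UnitAddCircle)) t := by
    intro t
    simp_rw [hxt]
    refine ((hasDerivAt_prim (q * x + r) t).const_sub c).congr_deriv ?_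
    simp only [ContinuousMap.add_apply, ContinuousMap.mul_apply, hxt, ← hκ]
    ring
  have hint := intervalIntegral.integral_eq_sub_of_hasDerivAt (a := 0) (b := t)
    (f := fun t : ℝ => x (t : UnitAddCircle) * expInt q t)
    (f' := fun s : ℝ => (κ - r (s : UnitAddCircle)) * expInt q s)
    (fun s _ => ((hderiv s).fun_mul (hasDerivAt_expInt q s)).congr_deriv (by ring))
    (((continuous_const.sub r.continuous_coe).mul (continuous_expInt q)).intervalIntegrable _ _)
  rw [hint, expInt_zero, hxt 0, prim_zero]
  ring

lemma mean_mul_integral_expInt (hx : x + prim (q * x + r) = ContinuousMap.const _ c) :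
    mean (q * x + r) * ∫ s in (0 : ℝ)..1, expInt q s
      = (∫ s in (0 : ℝ)..1, r (s : UnitAddCircle) * expInt q s)
        + c * (Real.exp (mean q) - 1) := by
  have h := mul_expInt_eq hx 1
  have hx1 : x ((1 : ℝ) : UnitAddCircle) = c := by
    have hx0 := DFunLike.congr_fun hx ((0 : ℝ) : UnitAddCircle)
    rwa [ContinuousMap.add_apply, prim_zero, add_zero, ← coe_one_circle] at hx0
  rw [integral_const_sub_mul_expInt, hx1, expInt_one] at h
  linarith

lemma abs_mean_le_of_add_prim_eq_zero (hx : x + prim (q * x + r) = 0) :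
    |mean (q * x + r)| ≤ ‖r‖ := by
  have hI := integral_expInt_pos q
  have hmean := mean_mul_integral_expInt (c := 0) hx
  have hle := abs_integral_mul_expInt_le q r zero_le_one
  rw [zero_mul, add_zero] at hmean
  rw [← hmean, abs_mul, abs_of_pos hI] at hle
  exact le_of_mul_le_mul_right hle hI

lemma norm_le_of_add_prim_eq_zero (hx : x + prim (q * x + r) = 0) :
    ‖x‖ ≤ 2 * Real.exp ‖q‖ ^ 2 * ‖r‖ := by
  refine (ContinuousMap.norm_le _ (by positivity)).mpr fun y => ?_
  obtain ⟨t, ht, rfl⟩ := exists_mem_Ico_coe y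
  replace ht := Ico_subset_Icc_self ht
  let w : C0 := ContinuousMap.const _ (mean (q * x + r)) - r
  have hw : ‖w‖ ≤ 2 * ‖r‖ := by
    refine (ContinuousMap.norm_le _ (by positivity)).mpr fun s => (abs_sub _ _).trans ?_
    rw [two_mul]
    exact add_le_add (abs_mean_le_of_add_prim_eq_zero hx) (r.abs_le s)
  have hxw : x (t : UnitAddCircle) * expInt q t
      = ∫ s in (0 : ℝ)..t, w (s : UnitAddCircle) * expInt q s :=
    (mul_expInt_eq (c := 0) hx t).trans (zero_add _)
  have hbound : |x (t : UnitAddCircle)| * Real.exp (-‖q‖) ≤ 2 * ‖r‖ * Real.exp ‖q‖ :=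
    calc |x (t : UnitAddCircle)| * Real.exp (-‖q‖) ≤ |x (t : UnitAddCircle)| * expInt q t := by
          gcongr
          exact exp_neg_norm_le_expInt q ht
      _ = |∫ s in (0 : ℝ)..t, w (s : UnitAddCircle) * expInt q s| := by
          rw [← hxw, abs_mul, abs_of_pos (expInt_pos q t)]
      _ ≤ ‖w‖ * ∫ s in (0 : ℝ)..t, expInt q s := abs_integral_mul_expInt_le q w ht.1
      _ ≤ 2 * ‖r‖ * Real.exp ‖q‖ := by
          exact mul_le_mul hw (integral_expInt_le q ht)
            (intervalIntegral.integral_nonneg ht.1 fun s _ => (expInt_pos q s).le) (by positivity)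
  rw [Real.exp_neg, ← div_eq_mul_inv, div_le_iff₀ (Real.exp_pos _)] at hbound
  exact hbound.trans_eq (by ring)

end Solution

lemma exists_periodic_solution (q r : C0) : ∃ (κ : ℝ) (z : ℝ → ℝ), z 0 = 0 ∧ z 1 = 0 ∧
    ∀ t : ℝ, HasDerivAt z (κ - (q (t : UnitAddCircle) * z t + r (t : UnitAddCircle))) t := by
  let κ := (∫ s in (0 : ℝ)..1, r (s : UnitAddCircle) * expInt q s)
    / ∫ s in (0 : ℝ)..1, expInt q s
  have hcont : Continuous fun s : ℝ => (κ - r (s : UnitAddCircle)) * expInt q s :=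
    (continuous_const.sub r.continuous_coe).mul (continuous_expInt q)
  refine ⟨κ, fun t => (∫ s in (0 : ℝ)..t, (κ - r (s : UnitAddCircle)) * expInt q s)
    * (expInt q t)⁻¹, by simp, ?_, fun t => ?_⟩
  · beta_reduce
    rw [integral_const_sub_mul_expInt, div_mul_cancel₀ _ (integral_expInt_pos q).ne', sub_self,
      zero_mul]
  · have hE := (expInt_pos q t).ne'
    refine ((hcont.integral_hasStrictDerivAt 0 t).hasDerivAt.fun_mul
      ((hasDerivAt_expInt q t).fun_inv hE)).congr_deriv ?_
    field_simp
    ring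

lemma exists_add_prim_eq_zero (q r : C0) : ∃ x : C0, x + prim (q * x + r) = 0 := by
  obtain ⟨κ, z, hz0, hz1, hz⟩ := exists_periodic_solution q r
  have hzc : ContinuousOn z (Icc 0 1) := fun t _ => (hz t).continuousAt.continuousWithinAt
  let x := liftUnit z hzc (hz0.trans hz1.symm)
  have hxz : ∀ t ∈ Icc (0 : ℝ) 1, x (t : UnitAddCircle) = z t := fun t ht =>
    liftUnit_apply _ _ ht
  obtain ⟨hx, -⟩ := eq_const_add_prim (u := x) (u' := κ • 1 - (q * x + r)) fun t ht => by
    refine ((hz t).congr_of_eventuallyEq ?_).congr_deriv ?_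
    · filter_upwards [Icc_mem_nhds ht.1 ht.2] with s hs using hxz s hs
    · simp [hxz t (Ioo_subset_Icc_self ht)]
  refine ⟨x, ?_⟩
  rw [hxz 0 ⟨le_rfl, zero_le_one⟩, hz0, map_sub, map_smul, prim_one, smul_zero, zero_sub] at hx
  rw [← eq_neg_iff_add_eq_zero]
  exact hx.trans (zero_add _)

/-- The operator `x ↦ x + prim (q * x)`, the linearization of `u ↦ u + prim (f ∘ u)` at a
function `u` with `f' ∘ u = q`. -/
noncomputable def linOp (q : C0) : C0 →L[ℝ] C0 :=
  ContinuousLinearMap.id ℝ C0 + prim.comp (ContinuousLinearMap.mul ℝ C0 q)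

lemma linOp_apply (q x : C0) : linOp q x = x + prim (q * x) := rfl

lemma norm_le_norm_linOp (q x : C0) :
    ‖x‖ ≤ (1 + 2 * Real.exp ‖q‖ ^ 2 * ‖q‖) * ‖linOp q x‖ := by
  set g := linOp q x with hg
  have heq : (x - g) + prim (q * (x - g) + q * g) = 0 := by
    rw [← mul_add, sub_add_cancel, hg, linOp_apply]
    abel
  have htri : ‖x‖ ≤ ‖x - g‖ + ‖g‖ := by simpa using norm_add_le (x - g) g
  calc ‖x‖ ≤ 2 * Real.exp ‖q‖ ^ 2 * (‖q‖ * ‖g‖) + ‖g‖ :=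
        htri.trans (by grw [norm_le_of_add_prim_eq_zero heq, norm_mul_le])
    _ = _ := by ring

/-- The operator `x ↦ x + prim (q * x)` as an automorphism. -/
noncomputable def linEquiv (q : C0) : C0 ≃L[ℝ] C0 :=
  ContinuousLinearEquiv.ofBijective (linOp q)
    (LinearMap.ker_eq_bot'.mpr fun x hx => norm_le_zero_iff.mp <| by
      simpa [show linOp q x = 0 from hx] using norm_le_norm_linOp q x)
    (LinearMap.range_eq_top.mpr fun g => by
      obtain ⟨z, hz⟩ := exists_add_prim_eq_zero q (q * g)
      refine ⟨z + g, ?_⟩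
      change z + g + prim (q * (z + g)) = g
      rw [mul_add, add_right_comm, hz, zero_add])

lemma coe_linEquiv (q : C0) : (linEquiv q : C0 →L[ℝ] C0) = linOp q :=
  ContinuousLinearEquiv.coe_ofBijective _ _ _

/-! ### The nonlinear equation `u + prim (f ∘ u) = g` -/

/-- The derivative of a smooth function, as a continuous function. -/
noncomputable def derivMap (f : C(ℝ, ℝ)) (hf : ContDiff ℝ ∞ f) : C(ℝ, ℝ) :=
  ⟨deriv f, hf.continuous_deriv (by simp)⟩

/-- The map `u ↦ u + prim (f ∘ u)`. It sends a solution of `u' + f ∘ u = v` to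
`u 0 + prim v`. -/
noncomputable def addPrim (f : C(ℝ, ℝ)) (u : C0) : C0 := u + prim (f.comp u)

section Smooth

variable {f : C(ℝ, ℝ)} (hf : ContDiff ℝ ∞ f)
include hf

lemma contDiff_derivMap : ContDiff ℝ ∞ (derivMap f hf) :=
  (contDiff_infty_iff_deriv.mp hf).2

lemma hasDerivAt_derivMap (x : ℝ) : HasDerivAt f (derivMap f hf x) x :=
  ((contDiff_infty_iff_deriv.mp hf).1 x).hasDerivAt

lemma hasFDerivAt_comp (u : C0) :
    HasFDerivAt (fun u : C0 => f.comp u)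
      (ContinuousLinearMap.mul ℝ C0 ((derivMap f hf).comp u)) u := by
  obtain ⟨hdiff, hsmooth⟩ := contDiff_infty_iff_fderiv.mp hf
  let f' : C(ℝ, ℝ →L[ℝ] ℝ) := ⟨fderiv ℝ f, hsmooth.continuous⟩
  refine (hasFDerivAt_superposition (φ' := f') (fun x => (hdiff x).hasFDerivAt) u).congr_fderiv ?_
  ext w s
  change fderiv ℝ f (u s) (w s) = deriv f (u s) * w s
  rw [fderiv_eq_smul_deriv, smul_eq_mul, mul_comm]

lemma contDiff_addPrim : ContDiff ℝ ∞ (addPrim f) :=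
  contDiff_id.add (prim.contDiff.comp (contDiff_superposition hf))

lemma hasFDerivAt_addPrim (u : C0) :
    HasFDerivAt (addPrim f) (linEquiv ((derivMap f hf).comp u) : C0 →L[ℝ] C0) u := by
  rw [coe_linEquiv]
  exact (hasFDerivAt_id u).add (prim.hasFDerivAt.comp u (hasFDerivAt_comp hf u))

lemma exists_continuous_slope : ∃ δ : C(ℝ × ℝ, ℝ), ∀ a b, f a - f b = δ (a, b) * (a - b) := by
  obtain ⟨g, hg, hfg, -⟩ := exists_eq_mul_of_eq_zero (T := ℝ)
    (h := fun p : ℝ × ℝ => f (p.2 + p.1) - f p.2)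
    ((hf.comp (contDiff_snd.add contDiff_fst)).sub (hf.comp contDiff_snd)) (by simp)
  refine ⟨⟨fun p => g (p.1 - p.2, p.2), hg.continuous.comp (by fun_prop)⟩, fun a b => ?_⟩
  simpa [mul_comm] using hfg (a - b) b

/-- The difference `u - v` solves the linear equation whose coefficient is the slope of `f`
between `v` and `u`. -/
lemma norm_sub_le_norm_addPrim_sub (R : ℝ) :
    ∃ C : ℝ, ∀ u v : C0, ‖u‖ ≤ R → ‖v‖ ≤ R → ‖u - v‖ ≤ C * ‖addPrim f u - addPrim f v‖ := by
  obtain ⟨δ, hδ⟩ := exists_continuous_slope hf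
  obtain ⟨B, hB⟩ := ((isCompact_Icc (a := -R) (b := R)).prod
    (isCompact_Icc (a := -R) (b := R))).exists_bound_of_continuousOn δ.continuous.continuousOn
  refine ⟨1 + 2 * Real.exp |B| ^ 2 * |B|, fun u v hu hv => ?_⟩
  let q : C0 := ⟨fun s => δ (u s, v s), by fun_prop⟩
  have hq : ‖q‖ ≤ |B| := (ContinuousMap.norm_le _ (abs_nonneg _)).mpr fun s =>
    (hB _ ⟨abs_le.mp ((u.abs_le s).trans hu), abs_le.mp ((v.abs_le s).trans hv)⟩).trans
      (le_abs_self B)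
  have hmul : q * (u - v) = f.comp u - f.comp v := by
    ext s
    exact (hδ (u s) (v s)).symm
  have hlin : linOp q (u - v) = addPrim f u - addPrim f v := by
    rw [linOp_apply, hmul, map_sub, addPrim, addPrim]
    abel
  calc ‖u - v‖ ≤ _ := norm_le_norm_linOp q (u - v)
    _ ≤ _ := by
      rw [hlin]
      gcongr

end Smooth

lemma exists_forall_prim_ge (v : C0) : ∃ s, v s = mean v ∧ ∀ x, prim v s ≤ prim v x := by
  obtain ⟨s, -, hs⟩ := isCompact_univ.exists_isMinOn univ_nonempty (prim v).continuous.continuousOn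
  obtain ⟨t, -, rfl⟩ := exists_mem_Ico_coe s
  have hmin : ∀ x, prim v t ≤ prim v x := fun x => hs (mem_univ x)
  have hext : IsLocalExtr (fun t : ℝ => prim v (t : UnitAddCircle)) t :=
    Or.inl (Eventually.of_forall fun _ => hmin _)
  exact ⟨t, sub_eq_zero.mp (hext.hasDerivAt_eq_zero (hasDerivAt_prim v t)), hmin⟩

lemma exists_forall_prim_le (v : C0) : ∃ s, v s = mean v ∧ ∀ x, prim v x ≤ prim v s := by
  obtain ⟨s, hs, hmin⟩ := exists_forall_prim_ge (-v)
  exact ⟨s, by simpa using hs, fun x => by simpa using hmin x⟩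

lemma exists_mean_comp_le (f : C(ℝ, ℝ)) (u : C0) :
    ∃ x, mean (f.comp u) ≤ f (addPrim f u x) := by
  by_contra! hlt
  -- At a zero of `prim (f ∘ u)` the functions `u` and `addPrim f u` agree, so its derivative
  -- `f ∘ u - mean (f ∘ u)` is negative there; no periodic function has this property.
  have hpos := pos_of_deriv_pos_at_zeros
    (fun t : ℝ => (hasDerivAt_prim (f.comp u) t).fun_neg) (fun t ht => by
      have hu : addPrim f u (t : UnitAddCircle) = u (t : UnitAddCircle) := by
        simpa [addPrim] using ht
      simpa [hu] using hlt t) (a := 0) (b := 1) (by rw [prim_zero, neg_zero]) zero_lt_one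
  rw [coe_one_circle, prim_zero, neg_zero] at hpos
  exact lt_irrefl _ hpos

section Coercive

variable {f : C(ℝ, ℝ)} (hlim : Tendsto f (cocompact ℝ) atTop)
include hlim

lemma exists_forall_abs_gt (A : ℝ) : ∃ B, 0 ≤ B ∧ ∀ x, B < |x| → A < f x := by
  have hA := hlim.eventually_gt_atTop A
  rw [← Metric.cobounded_eq_cocompact, ← comap_norm_atTop, eventually_comap] at hA
  obtain ⟨B, hB⟩ := eventually_atTop.mp hA
  exact ⟨max B 0, le_max_right _ _, fun x hx => hB _ ((le_max_left _ _).trans hx.le) x rfl⟩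

lemma norm_le_of_norm_addPrim_le (r : ℝ) : ∃ R, ∀ u : C0, ‖addPrim f u‖ ≤ r → ‖u‖ ≤ R := by
  obtain ⟨M, hM⟩ := (isCompact_Icc (a := -r) (b := r)).exists_bound_of_continuousOn
    f.continuous.continuousOn
  obtain ⟨B, hB0, hB⟩ := exists_forall_abs_gt hlim M
  refine ⟨B + 2 * |r|, fun u hu => (ContinuousMap.norm_le _ (by positivity)).mpr fun x => ?_⟩
  have hg : ∀ x, |addPrim f u x| ≤ r := fun x => ((addPrim f u).abs_le x).trans hu
  have hmean : mean (f.comp u) ≤ M := by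
    obtain ⟨x, hx⟩ := exists_mean_comp_le f u
    exact hx.trans ((le_abs_self _).trans (hM _ (abs_le.mp (hg x))))
  have hB' : ∀ s, f (u s) = mean (f.comp u) → |u s| ≤ B := fun s hs => by
    by_contra! hlt
    exact (hB _ hlt).not_ge (hs.trans_le hmean)
  obtain ⟨s, hs, hmin⟩ := exists_forall_prim_ge (f.comp u)
  obtain ⟨t, ht, hmax⟩ := exists_forall_prim_le (f.comp u)
  have hu : ∀ x, u x = addPrim f u x - prim (f.comp u) x := fun x => by simp [addPrim]
  rw [Real.norm_eq_abs, abs_le]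
  constructor <;>
    linarith [hu x, hu s, hu t, hmin x, hmax x, abs_le.mp (hB' s hs), abs_le.mp (hB' t ht),
      abs_le.mp (hg x), abs_le.mp (hg s), abs_le.mp (hg t), le_abs_self r]

lemma isClosed_range_addPrim (hf : ContDiff ℝ ∞ f) : IsClosed (range (addPrim f)) := by
  refine IsSeqClosed.isClosed fun g a hg hga => ?_
  choose u hu using hg
  obtain ⟨r, hr⟩ := (Metric.isBounded_range_of_tendsto g hga).exists_norm_le
  obtain ⟨R, hR⟩ := norm_le_of_norm_addPrim_le hlim r
  have huR : ∀ n, ‖u n‖ ≤ R := fun n => hR _ (by rw [hu]; exact hr _ (mem_range_self n))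
  obtain ⟨C, hC⟩ := norm_sub_le_norm_addPrim_sub hf R
  have hdist : ∀ p : ℕ × ℕ, dist (u p.1) (u p.2) ≤ C * dist (g p.1) (g p.2) := fun p => by
    simpa only [dist_eq_norm, hu] using hC _ _ (huR p.1) (huR p.2)
  have hcauchy : CauchySeq u := cauchySeq_iff_tendsto_dist_atTop_0.mpr <|
    squeeze_zero (fun _ => dist_nonneg) hdist <| by
      simpa using (cauchySeq_iff_tendsto_dist_atTop_0.mp hga.cauchySeq).const_mul C
  obtain ⟨v, hv⟩ := cauchySeq_tendsto_of_complete hcauchy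
  exact ⟨v, tendsto_nhds_unique (((contDiff_addPrim hf).continuous.tendsto v).comp hv)
    (hga.congr fun n => (hu n).symm)⟩

lemma bijective_addPrim (hf : ContDiff ℝ ∞ f) : Function.Bijective (addPrim f) := by
  constructor
  · intro u v huv
    obtain ⟨C, hC⟩ := norm_sub_le_norm_addPrim_sub hf (max ‖u‖ ‖v‖)
    have hle := hC u v (le_max_left _ _) (le_max_right _ _)
    rw [huv, sub_self, norm_zero, mul_zero] at hle
    exact sub_eq_zero.mp (norm_le_zero_iff.mp hle)
  · have hopen : IsOpen (range (addPrim f)) :=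
      (isOpenMap_of_hasStrictFDerivAt_equiv fun u =>
        (contDiff_addPrim hf).contDiffAt.hasStrictFDerivAt' (hasFDerivAt_addPrim hf u)
          (by simp)).isOpen_range
    exact range_eq_univ.mp
      (IsClopen.eq_univ ⟨isClosed_range_addPrim hlim hf, hopen⟩ (range_nonempty _))

lemma exists_contDiff_inverse_addPrim (hf : ContDiff ℝ ∞ f) :
    ∃ S : C0 → C0, ContDiff ℝ ∞ S ∧ (∀ g, addPrim f (S g) = g) ∧ ∀ u, S (addPrim f u) = u := by
  let e := Equiv.ofBijective _ (bijective_addPrim hlim hf)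
  exact ⟨e.symm, contDiff_symm_of_hasFDerivAt e (contDiff_addPrim hf) fun u =>
    ⟨_, hasFDerivAt_addPrim hf u⟩, e.apply_symm_apply, e.symm_apply_apply⟩

lemma tendsto_mean_comp {S : C0 → C0} (hS : ∀ g, addPrim f (S g) = g) (g : C0) :
    Tendsto (fun y : ℝ => mean (f.comp (S (ContinuousMap.const _ y + g)))) (cocompact ℝ)
      atTop := by
  rw [tendsto_atTop]
  intro A
  obtain ⟨B, -, hB⟩ := exists_forall_abs_gt hlim A
  have hu : ∀ y x, S (ContinuousMap.const _ y + g) x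
      = y + g x - prim (f.comp (S (ContinuousMap.const _ y + g))) x := fun y x =>
    eq_sub_of_add_eq (DFunLike.congr_fun (hS (ContinuousMap.const _ y + g)) x)
  rw [cocompact_eq_atBot_atTop, eventually_sup]
  constructor
  · filter_upwards [eventually_lt_atBot (-B - ‖g‖)] with y hy
    obtain ⟨s, hs, hmax⟩ := exists_forall_prim_le (f.comp (S (ContinuousMap.const _ y + g)))
    have hle := hmax ((0 : ℝ) : UnitAddCircle)
    rw [prim_zero] at hle
    rw [← hs]
    exact (hB _ (lt_abs.mpr (Or.inr (by linarith [hu y s, abs_le.mp (g.abs_le s)])))).le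
  · filter_upwards [eventually_gt_atTop (B + ‖g‖)] with y hy
    obtain ⟨s, hs, hmin⟩ := exists_forall_prim_ge (f.comp (S (ContinuousMap.const _ y + g)))
    have hle := hmin ((0 : ℝ) : UnitAddCircle)
    rw [prim_zero] at hle
    rw [← hs]
    exact (hB _ (lt_abs.mpr (Or.inl (by linarith [hu y s, abs_le.mp (g.abs_le s)])))).le

end Coercive

/-! ### Derivatives of the average along vertical lines -/

section VanishingAverages

variable {q w a b x z : C0}

lemma mean_mul_integral_expInt_one (hw : w + prim (q * w) = 1) :
    mean (q * w) * ∫ s in (0 : ℝ)..1, expInt q s = Real.exp (mean q) - 1 := by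
  simpa using mean_mul_integral_expInt (r := 0) (c := 1) (by rw [add_zero, hw]; rfl)

variable (hw : w + prim (q * w) = 1) (hqw : mean (q * w) = 0)
include hw hqw

lemma mul_expInt_eq_one (t : ℝ) : w (t : UnitAddCircle) * expInt q t = 1 := by
  rw [mul_expInt_eq (r := 0) (c := 1) (by rw [add_zero, hw]; rfl) t, add_zero, hqw]
  simp

lemma mean_mul_integral_expInt_of_mul (hx : x + prim (q * x + a * w) = 0) :
    mean (q * x + a * w) * ∫ s in (0 : ℝ)..1, expInt q s = mean a := by
  rw [mean_mul_integral_expInt (c := 0) hx, zero_mul, add_zero, mean_eq]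
  refine intervalIntegral.integral_congr fun s _ => ?_
  simp only [ContinuousMap.mul_apply]
  rw [mul_assoc, mul_expInt_eq_one hw hqw, mul_one]

lemma eq_neg_mul_integral (hz : z + prim (q * z + a * w * w) = 0)
    (hmean : mean (q * z + a * w * w) = 0) (t : ℝ) : z (t : UnitAddCircle)
      = -(w (t : UnitAddCircle) * ∫ s in (0 : ℝ)..t, (a * w) (s : UnitAddCircle)) := by
  have hwE := mul_expInt_eq_one hw hqw
  have hint : ∫ s in (0 : ℝ)..t,
      (mean (q * z + a * w * w) - (a * w * w) (s : UnitAddCircle)) * expInt q s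
      = -∫ s in (0 : ℝ)..t, (a * w) (s : UnitAddCircle) := by
    rw [← intervalIntegral.integral_neg]
    refine intervalIntegral.integral_congr fun s _ => ?_
    simp only [hmean, ContinuousMap.mul_apply]
    linear_combination (-(a (s : UnitAddCircle) * w (s : UnitAddCircle))) * hwE s
  have hzE := mul_expInt_eq (c := 0) hz t
  rw [hint, zero_add] at hzE
  linear_combination w (t : UnitAddCircle) * hzE - z (t : UnitAddCircle) * hwE t

/-- If `A` is the primitive of `a * w`, then `a * z = -A * A'` is an exact derivative. -/
lemma mean_mul_eq_zero (hz : z + prim (q * z + a * w * w) = 0)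
    (hmean : mean (q * z + a * w * w) = 0) : mean (a * z) = 0 := by
  have haw : mean (a * w) = 0 := by
    rw [← mean_mul_integral_expInt_of_mul hw hqw hz, hmean, zero_mul]
  have hderiv : ∀ t : ℝ, HasDerivAt
      (fun t : ℝ => -(∫ s in (0 : ℝ)..t, (a * w) (s : UnitAddCircle)) ^ 2 / 2)
      ((a * z) (t : UnitAddCircle)) t := fun t => by
    refine ((hasDerivAt_integral (a * w) t).fun_pow 2).fun_neg.div_const 2 |>.congr_deriv ?_
    simp only [ContinuousMap.mul_apply, eq_neg_mul_integral hw hqw hz hmean]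
    ring
  rw [mean_eq, intervalIntegral.integral_eq_sub_of_hasDerivAt (fun s _ => hderiv s)
    ((a * z).intervalIntegrable _ _), ← mean_eq, haw]
  simp

lemma mean_mul_integral_expInt_of_mean_eq_zero (hz : z + prim (q * z + a * w * w) = 0)
    (hmean : mean (q * z + a * w * w) = 0)
    (hx : x + prim (q * x + (3 * a * z + b * w * w) * w) = 0) :
    mean (q * x + (3 * a * z + b * w * w) * w) * ∫ s in (0 : ℝ)..1, expInt q s
      = mean (b * w * w) := by
  have hthree : 3 * a * z = (3 : ℝ) • (a * z) := by
    ext s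
    change 3 * a s * z s = 3 * (a s * z s)
    ring
  rw [mean_mul_integral_expInt_of_mul hw hqw hx, map_add, hthree, map_smul,
    mean_mul_eq_zero hw hqw hz hmean, smul_zero, zero_add]

end VanishingAverages

lemma hasDerivAt_of_contDiff {F : Type*} [NormedAddCommGroup F] [NormedSpace ℝ F] {u : ℝ → F}
    (hu : ContDiff ℝ ∞ u) (y : ℝ) : HasDerivAt u (deriv u y) y :=
  ((contDiff_infty_iff_deriv.mp hu).1 y).hasDerivAt

lemma contDiff_deriv {F : Type*} [NormedAddCommGroup F] [NormedSpace ℝ F] {u : ℝ → F}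
    (hu : ContDiff ℝ ∞ u) : ContDiff ℝ ∞ (deriv u) :=
  (contDiff_infty_iff_deriv.mp hu).2

lemma deriv_clm_comp {E F : Type*} [NormedAddCommGroup E] [NormedSpace ℝ E]
    [NormedAddCommGroup F] [NormedSpace ℝ F] (A : E →L[ℝ] F) {u : ℝ → E} (hu : ContDiff ℝ ∞ u) :
    deriv (fun y => A (u y)) = fun y => A (deriv u y) :=
  funext fun y => (A.hasFDerivAt.comp_hasDerivAt y (hasDerivAt_of_contDiff hu y)).deriv

lemma hasDerivAt_const_add (g : C0) (y : ℝ) :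
    HasDerivAt (fun y : ℝ => (ContinuousMap.const _ y + g : C0)) 1 y := by
  have hsmul : (fun y : ℝ => (ContinuousMap.const _ y : C0)) = fun y => y • 1 := by
    ext y s
    simp
  simpa [hsmul] using ((hasDerivAt_id y).smul_const (1 : C0)).add_const g

section Line

variable {f : C(ℝ, ℝ)} (hf : ContDiff ℝ ∞ f)

/-- The second derivative as a continuous function. -/
noncomputable abbrev derivMap₂ : C(ℝ, ℝ) := derivMap (derivMap f hf) (contDiff_derivMap hf)

/-- The third derivative as a continuous function. -/
noncomputable abbrev derivMap₃ : C(ℝ, ℝ) :=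
  derivMap (derivMap₂ hf) (contDiff_derivMap (contDiff_derivMap hf))

variable {u : ℝ → C0} (hu : ContDiff ℝ ∞ u)
include hu

lemma hasDerivAt_comp_curve (y : ℝ) :
    HasDerivAt (fun y => f.comp (u y)) ((derivMap f hf).comp (u y) * deriv u y) y :=
  (hasFDerivAt_comp hf (u y)).comp_hasDerivAt y (hasDerivAt_of_contDiff hu y)

lemma deriv_comp_curve :
    deriv (fun y => f.comp (u y)) = fun y => (derivMap f hf).comp (u y) * deriv u y :=
  funext fun y => (hasDerivAt_comp_curve hf hu y).deriv

lemma deriv_deriv_comp_curve :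
    deriv (deriv fun y => f.comp (u y)) = fun y => (derivMap f hf).comp (u y) * deriv (deriv u) y
      + (derivMap₂ hf).comp (u y) * deriv u y * deriv u y := by
  rw [deriv_comp_curve hf hu]
  refine funext fun y => (((hasDerivAt_comp_curve (contDiff_derivMap hf) hu y).fun_mul
    (hasDerivAt_of_contDiff (contDiff_deriv hu) y)).congr_deriv ?_).deriv
  ring

lemma deriv_deriv_deriv_comp_curve :
    deriv (deriv (deriv fun y => f.comp (u y))) = fun y =>
      (derivMap f hf).comp (u y) * deriv (deriv (deriv u)) y
        + (3 * (derivMap₂ hf).comp (u y) * deriv (deriv u) y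
          + (derivMap₃ hf).comp (u y) * deriv u y * deriv u y) * deriv u y := by
  have hu' := contDiff_deriv hu
  rw [deriv_deriv_comp_curve hf hu]
  refine funext fun y => (HasDerivAt.congr_deriv (.fun_add
    ((hasDerivAt_comp_curve (contDiff_derivMap hf) hu y).fun_mul
      (hasDerivAt_of_contDiff (contDiff_deriv hu') y))
    (((hasDerivAt_comp_curve (contDiff_derivMap (contDiff_derivMap hf)) hu y).fun_mul
      (hasDerivAt_of_contDiff hu' y)).fun_mul (hasDerivAt_of_contDiff hu' y))) ?_).deriv
  ring

include hf in
lemma contDiff_comp_curve : ContDiff ℝ ∞ fun y => f.comp (u y) :=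
  (contDiff_superposition hf).comp hu

include hf in
lemma deriv_mean :
    deriv (fun y => mean (f.comp (u y))) = fun y => mean (deriv (fun y => f.comp (u y)) y) :=
  deriv_clm_comp mean (contDiff_comp_curve hf hu)

include hf in
lemma deriv_deriv_mean : deriv (deriv fun y => mean (f.comp (u y)))
    = fun y => mean (deriv (deriv fun y => f.comp (u y)) y) := by
  rw [deriv_mean hf hu, deriv_clm_comp mean (contDiff_deriv (contDiff_comp_curve hf hu))]

include hf in
lemma deriv_deriv_deriv_mean : deriv (deriv (deriv fun y => mean (f.comp (u y))))
    = fun y => mean (deriv (deriv (deriv fun y => f.comp (u y))) y) := by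
  rw [deriv_deriv_mean hf hu,
    deriv_clm_comp mean (contDiff_deriv (contDiff_deriv (contDiff_comp_curve hf hu)))]

variable {g : C0} (hg : ∀ y, addPrim f (u y) = ContinuousMap.const _ y + g)
include hg

include hf in
lemma deriv_line (y : ℝ) : deriv u y + prim (deriv (fun y => f.comp (u y)) y) = 1 :=
  HasDerivAt.unique ((hasDerivAt_of_contDiff hu y).fun_add (prim.hasFDerivAt.comp_hasDerivAt y
    (hasDerivAt_of_contDiff (contDiff_comp_curve hf hu) y)))
    ((hasDerivAt_const_add g y).congr_of_eventuallyEq (Eventually.of_forall hg))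

include hf in
lemma deriv_deriv_line (y : ℝ) :
    deriv (deriv u) y + prim (deriv (deriv fun y => f.comp (u y)) y) = 0 :=
  HasDerivAt.unique ((hasDerivAt_of_contDiff (contDiff_deriv hu) y).fun_add
    (prim.hasFDerivAt.comp_hasDerivAt y
      (hasDerivAt_of_contDiff (contDiff_deriv (contDiff_comp_curve hf hu)) y)))
    ((hasDerivAt_const y (1 : C0)).congr_of_eventuallyEq
      (Eventually.of_forall (deriv_line hf hu hg)))

include hf in
lemma deriv_deriv_deriv_line (y : ℝ) :
    deriv (deriv (deriv u)) y + prim (deriv (deriv (deriv fun y => f.comp (u y))) y) = 0 :=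
  HasDerivAt.unique ((hasDerivAt_of_contDiff (contDiff_deriv (contDiff_deriv hu)) y).fun_add
    (prim.hasFDerivAt.comp_hasDerivAt y
      (hasDerivAt_of_contDiff (contDiff_deriv (contDiff_deriv (contDiff_comp_curve hf hu))) y)))
    ((hasDerivAt_const y (0 : C0)).congr_of_eventuallyEq
      (Eventually.of_forall (deriv_deriv_line hf hu hg)))

lemma deriv_mean_mul (y : ℝ) :
    deriv (fun y => mean (f.comp (u y))) y
      * ∫ s in (0 : ℝ)..1, expInt ((derivMap f hf).comp (u y)) s
      = Real.exp (mean ((derivMap f hf).comp (u y))) - 1 := by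
  have hline := deriv_line hf hu hg y
  rw [deriv_mean hf hu]
  rw [deriv_comp_curve hf hu] at hline ⊢
  exact mean_mul_integral_expInt_one hline

lemma deriv_deriv_mean_mul {y : ℝ} (h₁ : deriv (fun y => mean (f.comp (u y))) y = 0) :
    deriv (deriv fun y => mean (f.comp (u y))) y
      * ∫ s in (0 : ℝ)..1, expInt ((derivMap f hf).comp (u y)) s
      = mean ((derivMap₂ hf).comp (u y) * deriv u y) := by
  have hline₁ := deriv_line hf hu hg y
  have hline₂ := deriv_deriv_line hf hu hg y
  rw [deriv_mean hf hu] at h₁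
  rw [deriv_deriv_mean hf hu]
  rw [deriv_comp_curve hf hu] at hline₁ h₁
  rw [deriv_deriv_comp_curve hf hu] at hline₂ ⊢
  exact mean_mul_integral_expInt_of_mul hline₁ h₁ hline₂

lemma deriv_deriv_deriv_mean_mul {y : ℝ} (h₁ : deriv (fun y => mean (f.comp (u y))) y = 0)
    (h₂ : deriv (deriv fun y => mean (f.comp (u y))) y = 0) :
    deriv (deriv (deriv fun y => mean (f.comp (u y)))) y
      * ∫ s in (0 : ℝ)..1, expInt ((derivMap f hf).comp (u y)) s
      = mean ((derivMap₃ hf).comp (u y) * deriv u y * deriv u y) := by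
  have hline₁ := deriv_line hf hu hg y
  have hline₂ := deriv_deriv_line hf hu hg y
  have hline₃ := deriv_deriv_deriv_line hf hu hg y
  rw [deriv_mean hf hu] at h₁
  rw [deriv_deriv_mean hf hu] at h₂
  rw [deriv_deriv_deriv_mean hf hu]
  rw [deriv_comp_curve hf hu] at hline₁ h₁
  rw [deriv_deriv_comp_curve hf hu] at hline₂ h₂
  rw [deriv_deriv_deriv_comp_curve hf hu] at hline₃ ⊢
  exact mean_mul_integral_expInt_of_mean_eq_zero hline₁ h₁ hline₂ h₂ hline₃

end Line

/-! ### Linear functionals along the curve of derivatives -/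

section Functionals

variable {V : Type*} [NormedAddCommGroup V] [NormedSpace ℝ V]

lemma exists_ne_zero_forall_apply_nonneg [FiniteDimensional ℝ V] {s : Set V} (hs : s.Nonempty)
    (h : (0 : V) ∉ interior (convexHull ℝ s)) :
    ∃ l : Module.Dual ℝ V, l ≠ 0 ∧ ∀ x ∈ s, 0 ≤ l x := by
  by_cases hi : (interior (convexHull ℝ s)).Nonempty
  · obtain ⟨l, hl⟩ := geometric_hahn_banach_open_point (convex_convexHull ℝ s).interior
      isOpen_interior h
    simp only [map_zero] at hl
    refine ⟨-l.toLinearMap, fun hl₀ => ?_, fun x hx => ?_⟩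
    · obtain ⟨x, hx⟩ := hi
      exact (hl x hx).ne (neg_eq_zero.mp (DFunLike.congr_fun hl₀ x))
    · have hx' : x ∈ closure (interior (convexHull ℝ s)) := by
        rw [(convex_convexHull ℝ s).closure_interior_eq_closure_of_nonempty_interior hi]
        exact subset_closure (subset_convexHull ℝ s hx)
      have hle : l x ≤ 0 := closure_minimal (fun y hy => (hl y hy).le)
        (isClosed_le l.continuous continuous_const) hx'
      simpa using hle
  · rw [interior_convexHull_nonempty_iff_affineSpan_eq_top,
      ← AffineSubspace.direction_eq_top_iff_of_nonempty ((affineSpan_nonempty ℝ).mpr hs)] at hi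
    obtain ⟨l, hl, hle⟩ := Submodule.exists_le_ker_of_lt_top _ (lt_top_iff_ne_top.mpr hi)
    obtain ⟨x₀, hx₀⟩ := hs
    have hconst : ∀ x ∈ s, l x = l x₀ := fun x hx => by
      rw [← sub_eq_zero, ← map_sub]
      refine hle ?_
      rw [direction_affineSpan]
      exact vsub_mem_vectorSpan ℝ hx hx₀
    rcases le_total 0 (l x₀) with hnonneg | hnonpos
    · exact ⟨l, hl, fun x hx => by rwa [hconst x hx]⟩
    · exact ⟨-l, neg_ne_zero.mpr hl, fun x hx => by simpa [hconst x hx] using hnonpos⟩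

variable {γ : ℝ → V}

lemma monotone_convexHull_image_Icc :
    Monotone fun n : ℕ => convexHull ℝ (γ '' Icc (-(n : ℝ)) n) := fun _ _ hmn =>
  convexHull_mono (image_mono
    (Icc_subset_Icc (neg_le_neg (Nat.cast_le.mpr hmn)) (Nat.cast_le.mpr hmn)))

lemma exists_smul_mem_convexHull_image_Icc (h : (0 : V) ∈ interior (convexHull ℝ (range γ)))
    (v : V) : ∃ ε : ℝ, 0 < ε ∧ ∃ n : ℕ, ε • v ∈ convexHull ℝ (γ '' Icc (-(n : ℝ)) n) := by
  have hsub : convexHull ℝ (range γ) ⊆ ⋃ n : ℕ, convexHull ℝ (γ '' Icc (-(n : ℝ)) n) := by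
    refine convexHull_min ?_ (monotone_convexHull_image_Icc.directed_le.convex_iUnion
      fun n => convex_convexHull ℝ _)
    rintro _ ⟨x, rfl⟩
    obtain ⟨n, hn⟩ := exists_nat_ge |x|
    exact mem_iUnion.mpr ⟨n, subset_convexHull ℝ _ ⟨x, abs_le.mp hn, rfl⟩⟩
  have htend : Tendsto (fun ε : ℝ => ε • v) (𝓝[>] 0) (𝓝 0) := by
    have hcont : Continuous fun ε : ℝ => ε • v := by fun_prop
    simpa using (hcont.tendsto 0).mono_left nhdsWithin_le_nhds
  obtain ⟨ε, hε, hpos⟩ :=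
    ((htend.eventually (mem_interior_iff_mem_nhds.mp h)).and self_mem_nhdsWithin).exists
  exact ⟨ε, hpos, mem_iUnion.mp (hsub hε)⟩

lemma exists_forall_ne_zero_exists_apply_neg [FiniteDimensional ℝ V]
    (h : (0 : V) ∈ interior (convexHull ℝ (range γ))) :
    ∃ M : ℝ, 0 < M ∧ ∀ l : Module.Dual ℝ V, l ≠ 0 → ∃ x ∈ Icc (-M) M, l (γ x) < 0 := by
  choose ε hε n hn using exists_smul_mem_convexHull_image_Icc h
  let b := Module.finBasis ℝ V
  obtain ⟨N, hN⟩ : BddAbove (n '' (range b ∪ range fun i => -b i)) :=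
    (((finite_range _).union (finite_range _)).image n).bddAbove
  refine ⟨N + 1, by positivity, fun l hl => ?_⟩
  by_contra! hc
  have hhull : ∀ v ∈ convexHull ℝ (γ '' Icc (-(N : ℝ)) N), 0 ≤ l v := by
    refine convexHull_min (t := {v | 0 ≤ l v}) ?_ (convex_halfSpace_ge l.isLinear 0)
    rintro _ ⟨x, hx, rfl⟩
    exact hc x ⟨by linarith [hx.1], by linarith [hx.2]⟩
  have hnonneg : ∀ v ∈ range b ∪ range fun i => -b i, 0 ≤ l v := fun v hv => by
    have hεv := hhull _ (monotone_convexHull_image_Icc (hN (mem_image_of_mem n hv)) (hn v))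
    rw [map_smul, smul_eq_mul] at hεv
    exact nonneg_of_mul_nonneg_right hεv (hε v)
  refine hl (b.ext fun i => le_antisymm ?_ (hnonneg _ (Or.inl (mem_range_self i))))
  simpa using hnonneg _ (Or.inr (mem_range_self i))

end Functionals

lemma IsGood.exists_apply_gammaHat_ne_zero {k : ℕ} {f : ℝ → ℝ} (h : IsGood k f)
    {l : Module.Dual ℝ (Fin k → ℝ)} (hl : l ≠ 0) {x y : ℝ} (hxy : x < y) :
    ∃ s ∈ Ioo x y, l (gammaHat k f s) ≠ 0 := by
  have hnot := h.2 x y hxy (LinearMap.ker l) (by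
    simpa using Module.Dual.finrank_ker_add_one_of_ne_zero (K := ℝ) (f := l) hl)
  rwa [image_subset_iff, not_subset] at hnot

section Curve

variable {f : C(ℝ, ℝ)} (hf : ContDiff ℝ ∞ f)

lemma gammaHat_zero (k : ℕ) (x : ℝ) : gammaHat (k + 1) f x 0 = derivMap f hf x := by
  simp [gammaHat, derivMap, iteratedDeriv_one]

lemma gammaHat_one (k : ℕ) (x : ℝ) : gammaHat (k + 2) f x 1 = derivMap₂ hf x := by
  simp [gammaHat, derivMap, iteratedDeriv_succ]

lemma gammaHat_two (x : ℝ) : gammaHat 3 f x 2 = derivMap₃ hf x := by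
  simp [gammaHat, derivMap, iteratedDeriv_succ]

lemma dotProductEquiv_gammaHat_two (a b x : ℝ) :
    dotProductEquiv ℝ (Fin 2) ![a, b] (gammaHat 2 f x)
      = a * derivMap f hf x + b * derivMap₂ hf x := by
  rw [dotProductEquiv_apply_apply, dotProduct, Fin.sum_univ_two, gammaHat_zero hf 1,
    gammaHat_one hf 0]
  rfl

lemma dotProductEquiv_gammaHat_three (a b c x : ℝ) :
    dotProductEquiv ℝ (Fin 3) ![a, b, c] (gammaHat 3 f x)
      = a * derivMap f hf x + b * derivMap₂ hf x + c * derivMap₃ hf x := by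
  rw [dotProductEquiv_apply_apply, dotProduct, Fin.sum_univ_three, gammaHat_zero hf 2,
    gammaHat_one hf 1, gammaHat_two hf]
  rfl

lemma dotProductEquiv_pair_ne_zero {a b : ℝ} (h : a ≠ 0 ∨ b ≠ 0) :
    dotProductEquiv ℝ (Fin 2) ![a, b] ≠ 0 := by
  rw [LinearEquiv.map_ne_zero_iff]
  contrapose! h
  simpa using h

lemma IsGood.derivMap₂_ne_zero (h₂ : IsGood 2 f) {x : ℝ} (hx : derivMap f hf x = 0) :
    derivMap₂ hf x ≠ 0 := fun hx' => h₂.1 x <| by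
  ext i
  fin_cases i
  · simpa [hx] using gammaHat_zero hf 1 x
  · simpa [hx'] using gammaHat_one hf 0 x

lemma IsGood.exists_combination_two_ne_zero (h₂ : IsGood 2 f) {a b x y : ℝ} (hb : b ≠ 0)
    (hxy : x < y) : ∃ s ∈ Ioo x y, a * derivMap f hf s + b * derivMap₂ hf s ≠ 0 := by
  simpa only [dotProductEquiv_gammaHat_two hf] using
    h₂.exists_apply_gammaHat_ne_zero (dotProductEquiv_pair_ne_zero (a := a) (Or.inr hb)) hxy

lemma IsGood.exists_combination_three_ne_zero (h₃ : IsGood 3 f) {a b c x y : ℝ} (hc : c ≠ 0)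
    (hxy : x < y) :
    ∃ s ∈ Ioo x y, a * derivMap f hf s + b * derivMap₂ hf s + c * derivMap₃ hf s ≠ 0 := by
  have hl : dotProductEquiv ℝ (Fin 3) ![a, b, c] ≠ 0 := by
    rw [LinearEquiv.map_ne_zero_iff]
    exact fun h => hc (congrFun h 2)
  simpa only [dotProductEquiv_gammaHat_three hf] using h₃.exists_apply_gammaHat_ne_zero hl hxy

lemma IsGood.exists_combination_comp_ne_zero (h₂ : IsGood 2 f) {u : C0}
    (hu : mean ((derivMap f hf).comp u) = 0) {a b : ℝ} (hb : b ≠ 0) :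
    ∃ s, a * derivMap f hf (u s) + b * derivMap₂ hf (u s) ≠ 0 := by
  by_contra! hc
  by_cases hconst : ∀ t : ℝ, u t = u ((0 : ℝ) : UnitAddCircle)
  · have hzero : derivMap f hf (u ((0 : ℝ) : UnitAddCircle)) = 0 := by
      rw [mean_eq] at hu
      simpa [hconst] using hu
    have hsum := hc ((0 : ℝ) : UnitAddCircle)
    rw [hzero, mul_zero, zero_add] at hsum
    exact mul_ne_zero hb (h₂.derivMap₂_ne_zero hf hzero) hsum
  · push Not at hconst
    obtain ⟨t, ht⟩ := hconst
    obtain ⟨x, hx, hne⟩ := h₂.exists_combination_two_ne_zero hf (a := a) hb (min_lt_max.mpr ht)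
    obtain ⟨s, -, hs⟩ := intermediate_value_uIcc (f := fun t : ℝ => u (t : UnitAddCircle))
      u.continuous_coe.continuousOn (Ioo_subset_Icc_self hx)
    exact hne (hs ▸ hc (s : UnitAddCircle))

lemma mean_pos_of_nonneg {k : C0} (hk : ∀ s, 0 ≤ k s) {s : UnitAddCircle} (hs : k s ≠ 0) :
    0 < mean k := by
  rw [mean_eq_integral]
  exact k.continuous.integral_pos_of_hasCompactSupport_nonneg_nonzero
    (HasCompactSupport.of_compactSpace _) hk hs

lemma mean_derivMap₂_comp_mul_pos (h₂ : IsGood 2 f) {a b : ℝ} (hb : 0 < b)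
    (hab : ∀ x, 0 ≤ a * derivMap f hf x + b * derivMap₂ hf x) {u w : C0} (hw : ∀ s, 0 < w s)
    (hu : mean ((derivMap f hf).comp u) = 0) (huw : mean ((derivMap f hf).comp u * w) = 0) :
    0 < mean ((derivMap₂ hf).comp u * w) := by
  obtain ⟨s, hs⟩ := h₂.exists_combination_comp_ne_zero hf hu (a := a) hb.ne'
  set k : C0 := (a • (derivMap f hf).comp u + b • (derivMap₂ hf).comp u) * w with hk
  have hpos : 0 < mean k :=
    mean_pos_of_nonneg (fun s => mul_nonneg (hab (u s)) (hw s).le) (mul_ne_zero hs (hw s).ne')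
  rw [hk, add_mul, smul_mul_assoc, smul_mul_assoc, map_add, map_smul, map_smul, huw, smul_zero,
    zero_add, smul_eq_mul] at hpos
  exact pos_of_mul_pos_right hpos hb.le

lemma exists_derivMap_neg (hlim : Tendsto f (cocompact ℝ) atTop) : ∃ x, derivMap f hf x < 0 := by
  by_contra! hnonneg
  have hmono : Monotone f := monotone_of_hasDerivAt_nonneg (hasDerivAt_derivMap hf) hnonneg
  obtain ⟨hbot, -⟩ := tendsto_sup.mp (cocompact_eq_atBot_atTop (α := ℝ) ▸ hlim)
  obtain ⟨y, hy, hy0⟩ :=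
    ((hbot.eventually_gt_atTop (f 0)).and (eventually_le_atBot (0 : ℝ))).exists
  exact (hmono hy0).not_gt hy

lemma exists_derivMap_pos (hlim : Tendsto f (cocompact ℝ) atTop) : ∃ x, 0 < derivMap f hf x := by
  by_contra! hnonpos
  have hanti : Antitone f := antitone_of_hasDerivAt_nonpos (hasDerivAt_derivMap hf) hnonpos
  obtain ⟨-, htop⟩ := tendsto_sup.mp (cocompact_eq_atBot_atTop (α := ℝ) ▸ hlim)
  obtain ⟨y, hy, hy0⟩ :=
    ((htop.eventually_gt_atTop (f 0)).and (eventually_ge_atTop (0 : ℝ))).exists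
  exact (hanti hy0).not_gt hy

lemma IsGood.exists_derivMap_eq_zero_derivMap₂_pos (h₂ : IsGood 2 f)
    (hlim : Tendsto f (cocompact ℝ) atTop) :
    ∃ x, derivMap f hf x = 0 ∧ 0 < derivMap₂ hf x := by
  obtain ⟨x, hx⟩ := f.continuous.exists_forall_le hlim
  have hcrit : derivMap f hf x = 0 :=
    IsLocalMin.hasDerivAt_eq_zero (Eventually.of_forall hx) (hasDerivAt_derivMap hf x)
  refine ⟨x, hcrit, lt_of_le_of_ne (le_of_not_gt fun hneg => ?_)
    (h₂.derivMap₂_ne_zero hf hcrit).symm⟩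
  have hmax : IsLocalMax f x :=
    isLocalMax_of_deriv_deriv_neg hneg hcrit f.continuous.continuousAt
  have hconst : (f : ℝ → ℝ) =ᶠ[𝓝 x] fun _ => f x := by
    filter_upwards [hmax] with y hy
    exact le_antisymm hy (hx y)
  have hzero : deriv (deriv f) x = 0 := by
    rw [hconst.deriv.deriv_eq]
    simp
  exact hneg.ne hzero

lemma IsGood.exists_combination_nonneg (h₂ : IsGood 2 f) (hlim : Tendsto f (cocompact ℝ) atTop)
    (h : (0 : Fin 2 → ℝ) ∉ interior (convexHull ℝ (range (gammaHat 2 f)))) :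
    ∃ a b : ℝ, 0 < b ∧ ∀ x, 0 ≤ a * derivMap f hf x + b * derivMap₂ hf x := by
  obtain ⟨l, hl, hnonneg⟩ := exists_ne_zero_forall_apply_nonneg (range_nonempty _) h
  obtain ⟨c, rfl⟩ := (dotProductEquiv ℝ (Fin 2)).surjective l
  obtain ⟨a, b, rfl⟩ : ∃ a b, c = ![a, b] := ⟨c 0, c 1, by ext i; fin_cases i <;> rfl⟩
  have hab : ∀ x, 0 ≤ a * derivMap f hf x + b * derivMap₂ hf x := fun x => by
    rw [← dotProductEquiv_gammaHat_two]
    exact hnonneg _ (mem_range_self x)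
  refine ⟨a, b, ?_, hab⟩
  obtain ⟨x₀, hcrit, hpos⟩ := h₂.exists_derivMap_eq_zero_derivMap₂_pos hf hlim
  have hb : 0 ≤ b := by
    have hx₀ := hab x₀
    rw [hcrit, mul_zero, zero_add] at hx₀
    exact nonneg_of_mul_nonneg_left hx₀ hpos
  refine hb.lt_of_ne' fun hb₀ => hl ?_
  obtain ⟨x, hx⟩ := exists_derivMap_neg hf hlim
  obtain ⟨y, hy⟩ := exists_derivMap_pos hf hlim
  have ha : a = 0 := by
    simp only [hb₀, zero_mul, add_zero] at hab
    exact le_antisymm (nonpos_of_mul_nonneg_left (hab x) hx)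
      (nonneg_of_mul_nonneg_left (hab y) hy)
  rw [ha, hb₀, LinearEquiv.map_eq_zero_iff]
  simp

end Curve

/-! ### Reparametrization of the circle -/

lemma coe_add_natCast (x : ℝ) (n : ℕ) : ((x + n : ℝ) : UnitAddCircle) = x := by
  have hper : Function.Periodic ((↑) : ℝ → UnitAddCircle) 1 := AddCircle.coe_add_period 1
  simpa using hper.nat_mul n x

/-- The continuous map on the circle induced by a continuous map of period `1` on the line. -/
noncomputable def ofPeriodic {X : Type*} [TopologicalSpace X] {F : ℝ → X} (hF : Continuous F)
    (hper : Function.Periodic F 1) : C(UnitAddCircle, X) :=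
  ⟨hper.lift, continuous_coinduced_dom.mpr hF⟩

lemma integral_natCast (u : C0) (n : ℕ) :
    ∫ s in (0 : ℝ)..n, u (s : UnitAddCircle) = n * mean u := by
  have h := prim_apply_real u n
  rw [← zero_add (n : ℝ), coe_add_natCast, prim_zero, zero_add] at h
  linarith

lemma surjective_primitive {r : C0} (hr : 0 < mean r) :
    Function.Surjective fun s : ℝ => ∫ x in (0 : ℝ)..s, r (x : UnitAddCircle) := by
  have hprim : ∀ s : ℝ, ∫ x in (0 : ℝ)..s, r (x : UnitAddCircle)
      = prim r (s : UnitAddCircle) + s * mean r := fun s => by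
    rw [prim_apply_real]
    ring
  refine (continuous_iff_continuousAt.mpr
    fun s => (hasDerivAt_integral r s).continuousAt).surjective ?_ ?_
  · refine tendsto_atTop_mono (f := fun s => -‖prim r‖ + s * mean r) (fun s => ?_)
      (tendsto_atTop_add_const_left _ _ (tendsto_id.atTop_mul_const hr))
    rw [hprim]
    linarith [neg_le_of_abs_le ((prim r).abs_le s)]
  · refine tendsto_atBot_mono (f := fun s => ‖prim r‖ + s * mean r) (fun s => ?_)
      (tendsto_atBot_add_const_left _ _ (tendsto_id.atBot_mul_const hr))
    rw [hprim]
    linarith [le_of_abs_le ((prim r).abs_le s)]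

lemma exists_inverse_primitive {r : C0} (hr : ∀ s, 0 < r s) {n : ℕ} (hn : mean r * n = 1) :
    ∃ σ : ℝ → ℝ, σ 0 = 0 ∧ (∀ x, σ (x + 1) = σ x + n) ∧
      ∀ x, HasDerivAt σ (r (σ x : UnitAddCircle))⁻¹ x := by
  set τ : ℝ → ℝ := fun s => ∫ x in (0 : ℝ)..s, r (x : UnitAddCircle) with hτ
  have hderiv : ∀ s : ℝ, HasDerivAt τ (r (s : UnitAddCircle)) s := hasDerivAt_integral r
  have hmono : StrictMono τ := strictMono_of_hasDerivAt_pos hderiv fun s => hr _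
  have hmean : 0 < mean r := mean_pos_of_nonneg (fun s => (hr s).le) (hr 0).ne'
  let e := hmono.orderIsoOfSurjective τ (surjective_primitive hmean)
  have hleft : ∀ s, e.symm (τ s) = s := e.symm_apply_apply
  have hright : ∀ x, τ (e.symm x) = x := e.apply_symm_apply
  have hadd : ∀ s, τ (s + n) = τ s + 1 := fun s => by
    have hs := prim_apply_real r s
    have hsn := prim_apply_real r (s + n)
    rw [coe_add_natCast] at hsn
    simp only [hτ]
    linarith
  refine ⟨e.symm, ?_, fun x => ?_, fun x => ?_⟩
  · have hzero : τ 0 = 0 := intervalIntegral.integral_same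
    rw [← hzero, hleft, hzero]
  · rw [← hleft (e.symm x + n), hadd, hright]
  · exact HasDerivAt.of_local_left_inverse e.symm.continuous.continuousAt (hderiv _) (hr _).ne'
      (Eventually.of_forall hright)

lemma exists_reparametrization {r : C0} (hr : ∀ s, 0 < r s) {n : ℕ} (hn : mean r * n = 1) :
    ∃ (φ : C(UnitAddCircle, UnitAddCircle)) (σ : ℝ → ℝ),
      (∀ t : ℝ, φ (t : UnitAddCircle) = (σ t : UnitAddCircle)) ∧ σ 0 = 0 ∧ σ 1 = n ∧
      ∀ x, HasDerivAt σ (r (σ x : UnitAddCircle))⁻¹ x := by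
  obtain ⟨σ, hzero, hadd, hderiv⟩ := exists_inverse_primitive hr hn
  have hper : Function.Periodic (fun x : ℝ => (σ x : UnitAddCircle)) 1 := fun x => by
    simp only [hadd, coe_add_natCast]
  have hcont : Continuous σ := continuous_iff_continuousAt.mpr fun x => (hderiv x).continuousAt
  refine ⟨ofPeriodic ((AddCircle.continuous_mk' (1 : ℝ)).comp hcont) hper, σ, hper.lift_coe, hzero,
    ?_, hderiv⟩
  rw [← zero_add (1 : ℝ), hadd, hzero, zero_add]

section Lift

variable {φ : C(UnitAddCircle, UnitAddCircle)} {σ : ℝ → ℝ} {r : C0}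
  (hφ : ∀ t : ℝ, φ (t : UnitAddCircle) = (σ t : UnitAddCircle)) (hr : ∀ s, 0 < r s)
  (hσ : ∀ x, HasDerivAt σ (r (σ x : UnitAddCircle))⁻¹ x)
include hr hσ

lemma hasDerivAt_comp_lift {Z : ℝ → ℝ} {Z' : C0}
    (hZ : ∀ t : ℝ, HasDerivAt Z ((Z' * r) (t : UnitAddCircle)) t) (t : ℝ) :
    HasDerivAt (fun t => Z (σ t)) (Z' (σ t : UnitAddCircle)) t := by
  refine ((hZ (σ t)).comp t (hσ t)).congr_deriv ?_
  rw [ContinuousMap.mul_apply, mul_inv_cancel_right₀ (hr _).ne']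

include hφ

lemma hasDerivAt_comp_reparametrization {Y Y' : C0}
    (hY : ∀ t : ℝ, HasDerivAt (fun t : ℝ => Y (t : UnitAddCircle))
      ((Y' * r) (t : UnitAddCircle)) t) (t : ℝ) :
    HasDerivAt (fun t : ℝ => Y.comp φ (t : UnitAddCircle)) (Y'.comp φ (t : UnitAddCircle)) t := by
  simp only [ContinuousMap.comp_apply, hφ]
  exact hasDerivAt_comp_lift hr hσ hY t

lemma mean_comp_reparametrization {n : ℕ} (hσ₀ : σ 0 = 0) (hσ₁ : σ 1 = n) (Y : C0) :
    mean (Y.comp φ) = n * mean (Y * r) := by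
  rw [mean_eq, intervalIntegral.integral_eq_sub_of_hasDerivAt
    (f := fun t => ∫ s in (0 : ℝ)..σ t, (Y * r) (s : UnitAddCircle))
    (fun t _ => ?_) (C0.intervalIntegrable (Y.comp φ) _ _)]
  · rw [hσ₁, hσ₀, integral_natCast, intervalIntegral.integral_same, sub_zero]
  · rw [ContinuousMap.comp_apply, hφ]
    exact hasDerivAt_comp_lift hr hσ (hasDerivAt_integral (Y * r)) t

end Lift

/-! ### Positive densities orthogonal to given functions -/

/-- The functional `ρ ↦ ∫ k ρ`. -/
noncomputable def meanMul (k : C0) : C0 →L[ℝ] ℝ := mean.comp (ContinuousLinearMap.mul ℝ C0 k)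

lemma meanMul_apply (k ρ : C0) : meanMul k ρ = mean (k * ρ) := rfl

lemma exists_combination_of_ker {k₁ k₂ : C0} {Λ : C0 →ₗ[ℝ] ℝ}
    (h : ∀ ρ, mean (k₁ * ρ) = 0 → mean (k₂ * ρ) = 0 → Λ ρ = 0) :
    ∃ a b : ℝ, ∀ ρ, Λ ρ = mean ((a • k₁ + b • k₂) * ρ) := by
  have hker : ⨅ i, LinearMap.ker (![(meanMul k₁).toLinearMap, (meanMul k₂).toLinearMap] i)
      ≤ LinearMap.ker Λ := fun ρ hρ => by
    rw [Submodule.mem_iInf] at hρ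
    exact h ρ (hρ 0) (hρ 1)
  have hspan := mem_span_of_iInf_ker_le_ker hker
  rw [Submodule.mem_span_range_iff_exists_fun] at hspan
  obtain ⟨c, rfl⟩ := hspan
  refine ⟨c 0, c 1, fun ρ => ?_⟩
  rw [add_mul, map_add, smul_mul_assoc, smul_mul_assoc, map_smul, map_smul]
  simp [Fin.sum_univ_two, meanMul_apply]

lemma isOpen_forall_pos : IsOpen {ρ : C0 | ∀ s, 0 < ρ s} := by
  convert! ContinuousMap.isOpen_setOfPred_mapsTo (X := UnitAddCircle) (Y := ℝ) isCompact_univ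
    (isOpen_Ioi (a := 0)) using 2
  ext ρ
  simp [MapsTo]

lemma convex_forall_pos : Convex ℝ {ρ : C0 | ∀ s, 0 < ρ s} := by
  rw [ofPred_forall]
  exact convex_iInter fun s =>
    (convex_Ioi (0 : ℝ)).linear_preimage (ContinuousMap.evalCLM ℝ s).toLinearMap

/-- The density is the positive part of `k`, plus a small constant. -/
lemma exists_pos_mean_mul_nonneg {k : C0} {s : UnitAddCircle} (hs : 0 < k s) :
    ∃ ρ : C0, (∀ s, 0 < ρ s) ∧ 0 ≤ mean (k * ρ) := by
  set p : C0 := ⟨fun s => max (k s) 0, k.continuous.max continuous_const⟩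
  have hp : ∀ s, 0 ≤ p s := fun s => le_max_right _ _
  have hkp : ∀ s, (k * p) s = p s ^ 2 := fun s => by
    change k s * max (k s) 0 = max (k s) 0 ^ 2
    rcases le_total (k s) 0 with h | h
    · rw [max_eq_right h]
      ring
    · rw [max_eq_left h]
      ring
  have hmean : 0 < mean (k * p) := by
    refine mean_pos_of_nonneg (s := s) (fun s => hkp s ▸ sq_nonneg _) ?_
    rw [hkp]
    exact pow_ne_zero 2 (lt_max_of_lt_left hs).ne'
  set ε := mean (k * p) / (|mean k| + 1) with hε
  have hε₀ : 0 < ε := by positivity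
  refine ⟨p + ε • 1, fun s => add_pos_of_nonneg_of_pos (hp s) (by simpa using hε₀), ?_⟩
  have hle : ε * |mean k| ≤ mean (k * p) := by
    rw [hε, div_mul_eq_mul_div, div_le_iff₀ (by positivity)]
    nlinarith [abs_nonneg (mean k)]
  have hge : -(ε * |mean k|) ≤ ε * mean k := by
    rw [← mul_neg]
    exact mul_le_mul_of_nonneg_left (neg_abs_le _) hε₀.le
  rw [mul_add, map_add, mul_smul_comm, map_smul, mul_one, smul_eq_mul]
  linarith

lemma exists_pos_mean_mul_eq_zero {k₁ k₂ : C0}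
    (h : ∀ a b : ℝ, (a ≠ 0 ∨ b ≠ 0) → ∃ s, 0 < (a • k₁ + b • k₂) s) :
    ∃ ρ : C0, (∀ s, 0 < ρ s) ∧ mean (k₁ * ρ) = 0 ∧ mean (k₂ * ρ) = 0 := by
  by_contra! hc
  set N : Submodule ℝ C0 :=
    LinearMap.ker (meanMul k₁).toLinearMap ⊓ LinearMap.ker (meanMul k₂).toLinearMap
  have hdisj : Disjoint {ρ : C0 | ∀ s, 0 < ρ s} (N : Set C0) :=
    Set.disjoint_left.mpr fun ρ hρ hρN => hc ρ hρ hρN.1 hρN.2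
  obtain ⟨Λ, c, hΛ, hΛN⟩ :=
    geometric_hahn_banach_open convex_forall_pos isOpen_forall_pos N.convex hdisj
  have hc₀ : c ≤ 0 := by simpa using hΛN 0 N.zero_mem
  have hzero : ∀ ρ ∈ N, Λ ρ = 0 := fun ρ hρ => by
    by_contra hne
    have hlt := hΛN _ (N.smul_mem ((c - 1) / Λ ρ) hρ)
    rw [map_smul, smul_eq_mul, div_mul_cancel₀ _ hne] at hlt
    linarith
  obtain ⟨a, b, hab⟩ := exists_combination_of_ker (Λ := Λ.toLinearMap)
    fun ρ hρ₁ hρ₂ => hzero ρ ⟨hρ₁, hρ₂⟩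
  have hneg : ∀ ρ : C0, (∀ s, 0 < ρ s) → mean ((a • k₁ + b • k₂) * ρ) < 0 := fun ρ hρ => by
    rw [← hab]
    exact (hΛ ρ hρ).trans_le hc₀
  have hne : a ≠ 0 ∨ b ≠ 0 := by
    by_contra! hzero
    simpa [hzero.1, hzero.2] using hneg 1 fun _ => zero_lt_one
  obtain ⟨s, hs⟩ := h a b hne
  obtain ⟨ρ, hρ, hnonneg⟩ := exists_pos_mean_mul_nonneg hs
  exact (hneg ρ hρ).not_ge hnonneg

lemma exists_mean_mul_ne_zero {k₁ k₂ k₃ : C0} (h : ∀ a b : ℝ, k₃ ≠ a • k₁ + b • k₂) :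
    ∃ η : C0, mean (k₁ * η) = 0 ∧ mean (k₂ * η) = 0 ∧ mean (k₃ * η) ≠ 0 := by
  by_contra! hc
  obtain ⟨a, b, hab⟩ := exists_combination_of_ker (Λ := (meanMul k₃).toLinearMap) hc
  set d : C0 := k₃ - (a • k₁ + b • k₂) with hd
  have hsq : mean (d * d) = 0 := by
    conv_lhs => rw [hd, sub_mul, map_sub]
    exact sub_eq_zero.mpr (hab d)
  refine h a b (sub_eq_zero.mp (ContinuousMap.ext fun s => ?_))
  by_contra hne
  exact (mean_pos_of_nonneg (fun s => mul_self_nonneg (d s))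
    (mul_ne_zero hne hne)).ne' hsq

/-- A positive density orthogonal to `k₁` and `k₂` is perturbed, if necessary, in a direction
orthogonal to `k₁` and `k₂` but not to `k₃`. -/
lemma exists_pos_mean_mul_eq_zero_ne_zero {k₁ k₂ k₃ : C0}
    (hpos : ∀ a b : ℝ, (a ≠ 0 ∨ b ≠ 0) → ∃ s, 0 < (a • k₁ + b • k₂) s)
    (hne : ∀ a b : ℝ, k₃ ≠ a • k₁ + b • k₂) :
    ∃ ρ : C0, (∀ s, 0 < ρ s) ∧ mean (k₁ * ρ) = 0 ∧ mean (k₂ * ρ) = 0 ∧ mean (k₃ * ρ) ≠ 0 := by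
  obtain ⟨ρ, hρ, hρ₁, hρ₂⟩ := exists_pos_mean_mul_eq_zero hpos
  by_cases hρ₃ : mean (k₃ * ρ) = 0
  swap
  · exact ⟨ρ, hρ, hρ₁, hρ₂, hρ₃⟩
  obtain ⟨η, hη₁, hη₂, hη₃⟩ := exists_mean_mul_ne_zero hne
  have hcont : Continuous fun ε : ℝ => ρ + ε • η := by fun_prop
  have hev : ∀ᶠ ε : ℝ in 𝓝[>] 0, ρ + ε • η ∈ {ρ : C0 | ∀ s, 0 < ρ s} :=
    ((hcont.tendsto 0).eventually_mem
      (isOpen_forall_pos.mem_nhds (by simpa using hρ))).filter_mono nhdsWithin_le_nhds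
  obtain ⟨ε, hε, hε₀⟩ := (hev.and self_mem_nhdsWithin).exists
  have hmean : ∀ k : C0, mean (k * (ρ + ε • η)) = mean (k * ρ) + ε * mean (k * η) := fun k => by
    rw [mul_add, map_add, mul_smul_comm, map_smul, smul_eq_mul]
  refine ⟨ρ + ε • η, hε, ?_, ?_, ?_⟩
  · rw [hmean, hρ₁, hη₁, mul_zero, add_zero]
  · rw [hmean, hρ₂, hη₂, mul_zero, add_zero]
  · rw [hmean, hρ₃, zero_add]
    exact mul_ne_zero (ne_of_gt hε₀) hη₃

/-! ### Construction of a cusp -/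

section Quotient

/-- The quotient `ρ / (C - G)`, with the denominator truncated below at `1` so that it depends
continuously on every real `C`. -/
noncomputable def truncQuotient (ρ G : C0) (C : ℝ) : C0 :=
  ρ * (⟨fun x => (max x 1)⁻¹, (continuous_id.max continuous_const).inv₀ fun _ =>
    (lt_max_of_lt_right zero_lt_one).ne'⟩ : C(ℝ, ℝ)).comp (ContinuousMap.const _ C + -G)

variable {ρ G : C0}

lemma continuous_truncQuotient : Continuous (truncQuotient ρ G) :=
  continuous_const.mul ((ContinuousMap.continuous_postcomp _).comp
    (continuous_iff_continuousAt.mpr fun C => (hasDerivAt_const_add (-G) C).continuousAt))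

lemma truncQuotient_pos (hρ : ∀ s, 0 < ρ s) (C : ℝ) (s : UnitAddCircle) :
    0 < truncQuotient ρ G C s :=
  mul_pos (hρ s) (inv_pos.mpr (lt_max_of_lt_right zero_lt_one))

lemma one_le_sub_apply {C : ℝ} (hC : ‖G‖ + 1 ≤ C) (s : UnitAddCircle) : 1 ≤ C - G s := by
  linarith [le_of_abs_le (G.abs_le s)]

lemma truncQuotient_apply {C : ℝ} (hC : ‖G‖ + 1 ≤ C) (s : UnitAddCircle) :
    truncQuotient ρ G C s = ρ s / (C - G s) := by
  change ρ s * (max (C + -G s) 1)⁻¹ = _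
  rw [← sub_eq_add_neg, max_eq_left (one_le_sub_apply hC s), div_eq_mul_inv]

lemma abs_mean_le (u : C0) : |mean u| ≤ ‖u‖ := by
  rw [mean_eq]
  exact abs_integral_le_norm u ⟨zero_le_one, le_rfl⟩

lemma mean_truncQuotient_le (hρ : ∀ s, 0 < ρ s) {C : ℝ} (hC : ‖G‖ + 1 ≤ C) :
    mean (truncQuotient ρ G C) ≤ ‖ρ‖ / (C - ‖G‖) := by
  have hden : 0 < C - ‖G‖ := by linarith
  refine (le_abs_self _).trans ((abs_mean_le _).trans ?_)
  rw [ContinuousMap.norm_le _ (by positivity)]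
  intro s
  rw [Real.norm_of_nonneg (truncQuotient_pos hρ C s).le, truncQuotient_apply hC]
  exact div_le_div₀ (norm_nonneg ρ) (le_of_abs_le (ρ.abs_le s)) hden
    (by linarith [le_of_abs_le (G.abs_le s)])

lemma exists_mean_truncQuotient_mul_eq_one (hρ : ∀ s, 0 < ρ s) {K : ℝ} (hK : ‖G‖ + 1 ≤ K) :
    ∃ (C : ℝ) (n : ℕ), K ≤ C ∧ mean (truncQuotient ρ G C) * n = 1 := by
  have hpos : 0 < mean (truncQuotient ρ G K) :=
    mean_pos_of_nonneg (fun s => (truncQuotient_pos hρ K s).le) (truncQuotient_pos hρ K 0).ne'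
  obtain ⟨n, hn⟩ := exists_nat_one_div_lt hpos
  set C₁ := K + ‖ρ‖ * (n + 1)
  have hKC₁ : K ≤ C₁ := le_add_of_nonneg_right (by positivity)
  have hle : mean (truncQuotient ρ G C₁) ≤ 1 / ((n : ℝ) + 1) := by
    refine (mean_truncQuotient_le hρ (hK.trans hKC₁)).trans ?_
    rw [div_le_div_iff₀ (by linarith) (by positivity), one_mul]
    linarith
  obtain ⟨C, hC, hCn⟩ := intermediate_value_Icc' hKC₁
    (mean.continuous.comp continuous_truncQuotient).continuousOn ⟨hle, hn.le⟩
  refine ⟨C, n + 1, hC.1, ?_⟩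
  rw [Function.comp_apply] at hCn
  rw [hCn, Nat.cast_add_one, one_div_mul_cancel (by positivity)]

end Quotient

/-- The solution is `w = (C - G) / C` and the density `r = ρ / (C - G)`, where `G` is the primitive
of `k * ρ` and `C` is large. -/
lemma exists_density_and_solution {k m ρ : C0} (hρ : ∀ s, 0 < ρ s) (hk : mean (k * ρ) = 0)
    (hm : mean (m * ρ) ≠ 0) :
    ∃ (r w : C0) (n : ℕ) (c : ℝ), (∀ s, 0 < r s) ∧ mean r * n = 1 ∧
      w ((0 : ℝ) : UnitAddCircle) = 1 ∧
      (∀ t : ℝ, HasDerivAt (fun t : ℝ => w (t : UnitAddCircle))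
        ((-(k * w) * r) (t : UnitAddCircle)) t) ∧
      w * r = c • ρ ∧ mean (m * w * w * r) ≠ 0 := by
  set G : C0 := prim (k * ρ) with hG
  set z := mean (m * ρ * G) / mean (m * ρ) with hz
  obtain ⟨C, n, hC, hn⟩ := exists_mean_truncQuotient_mul_eq_one (G := G) hρ
    (le_add_of_nonneg_right (abs_nonneg z))
  have hGC : ‖G‖ + 1 ≤ C := (le_add_of_nonneg_right (abs_nonneg z)).trans hC
  have hC₀ : C ≠ 0 := by linarith [norm_nonneg G]
  set r := truncQuotient ρ G C
  set w : C0 := C⁻¹ • (ContinuousMap.const _ C - G) with hw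
  have hwr : w * r = C⁻¹ • ρ := by
    ext s
    change C⁻¹ * (C - G s) * r s = C⁻¹ * ρ s
    rw [truncQuotient_apply hGC, mul_assoc, mul_div_cancel₀]
    linarith [one_le_sub_apply hGC s]
  refine ⟨r, w, n, C⁻¹, truncQuotient_pos hρ C, hn, ?_, fun t => ?_, hwr, ?_⟩
  · change C⁻¹ * (C - G ((0 : ℝ) : UnitAddCircle)) = 1
    rw [hG, prim_zero, sub_zero, inv_mul_cancel₀ hC₀]
  · refine (((hasDerivAt_prim (k * ρ) t).const_sub C).const_mul C⁻¹).congr_deriv ?_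
    rw [hk, neg_mul, mul_assoc, hwr]
    simp only [ContinuousMap.neg_apply, ContinuousMap.mul_apply, ContinuousMap.smul_apply,
      smul_eq_mul]
    ring
  · have hprod : m * w * w * r = (C⁻¹ * C⁻¹) • (C • (m * ρ) - m * ρ * G) := by
      rw [mul_assoc, hwr, hw]
      ext s
      simp only [ContinuousMap.mul_apply, ContinuousMap.smul_apply, ContinuousMap.sub_apply,
        ContinuousMap.const_apply, smul_eq_mul]
      ring
    rw [hprod, map_smul, map_sub, map_smul, smul_eq_mul, smul_eq_mul]
    refine mul_ne_zero (by positivity) (sub_ne_zero.mpr fun hCm => ?_)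
    have hCz : C = z := by rw [hz, ← hCm, mul_div_cancel_right₀ _ hm]
    linarith [norm_nonneg G, le_abs_self z]

lemma exists_oscillation {M : ℝ} (hM : 0 < M) :
    ∃ U U' : C0, (∀ t : ℝ, HasDerivAt (fun t : ℝ => U (t : UnitAddCircle)) (U' t) t) ∧
      ∀ x ∈ Icc (-M) M, ∃ s, U s = x := by
  have hcos : Function.Periodic (fun t : ℝ => M * Real.cos (2 * Real.pi * t)) 1 := fun t => by
    simp only [mul_add, mul_one, Real.cos_add_two_pi]
  have hsin : Function.Periodic
      (fun t : ℝ => M * (-Real.sin (2 * Real.pi * t) * (2 * Real.pi))) 1 := fun t => by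
    simp only [mul_add, mul_one, Real.sin_add_two_pi]
  refine ⟨ofPeriodic (by fun_prop) hcos, ofPeriodic (by fun_prop) hsin, fun t => ?_,
    fun x hx => ?_⟩
  · refine (((hasDerivAt_id t).const_mul (2 * Real.pi)).cos.const_mul M).congr_deriv ?_
    simp only [id, mul_one]
    rfl
  · refine ⟨((Real.arccos (x / M) / (2 * Real.pi) : ℝ) : UnitAddCircle), ?_⟩
    change M * Real.cos (2 * Real.pi * (Real.arccos (x / M) / (2 * Real.pi))) = x
    rw [mul_div_cancel₀ _ (by positivity), Real.cos_arccos, mul_div_cancel₀ _ hM.ne']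
    · rw [le_div_iff₀ hM]
      linarith [hx.1]
    · rw [div_le_iff₀ hM]
      linarith [hx.2]

section CuspData

variable {f : C(ℝ, ℝ)} (hf : ContDiff ℝ ∞ f) (h₃ : IsGood 3 f)
  (h : (0 : Fin 2 → ℝ) ∈ interior (convexHull ℝ (range (gammaHat 2 f))))
include h₃ h

lemma exists_oscillation_density :
    ∃ U U' ρ : C0, (∀ t : ℝ, HasDerivAt (fun t : ℝ => U (t : UnitAddCircle)) (U' t) t) ∧
      (∀ s, 0 < ρ s) ∧ mean ((derivMap f hf).comp U * ρ) = 0 ∧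
      mean ((derivMap₂ hf).comp U * ρ) = 0 ∧ mean ((derivMap₃ hf).comp U * ρ) ≠ 0 := by
  obtain ⟨M, hM, hneg⟩ := exists_forall_ne_zero_exists_apply_neg h
  obtain ⟨U, U', hU, hUsurj⟩ := exists_oscillation hM
  have hpos : ∀ a b : ℝ, (a ≠ 0 ∨ b ≠ 0) →
      ∃ s, 0 < (a • (derivMap f hf).comp U + b • (derivMap₂ hf).comp U) s := fun a b hab => by
    obtain ⟨x, hx, hlt⟩ := hneg _ (dotProductEquiv_pair_ne_zero (a := -a) (b := -b) (by simpa))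
    obtain ⟨s, rfl⟩ := hUsurj x hx
    rw [dotProductEquiv_gammaHat_two hf] at hlt
    refine ⟨s, ?_⟩
    change 0 < a * derivMap f hf (U s) + b * derivMap₂ hf (U s)
    linarith
  have hne : ∀ a b : ℝ, (derivMap₃ hf).comp U
      ≠ a • (derivMap f hf).comp U + b • (derivMap₂ hf).comp U := fun a b hab => by
    obtain ⟨x, hx, hx₀⟩ := h₃.exists_combination_three_ne_zero hf (a := -a) (b := -b) one_ne_zero
      (show -M < M by linarith)
    obtain ⟨s, rfl⟩ := hUsurj x (Ioo_subset_Icc_self hx)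
    have hs : derivMap₃ hf (U s) = a * derivMap f hf (U s) + b * derivMap₂ hf (U s) :=
      DFunLike.congr_fun hab s
    refine hx₀ ?_
    linarith
  obtain ⟨ρ, hρ⟩ := exists_pos_mean_mul_eq_zero_ne_zero hpos hne
  exact ⟨U, U', ρ, hU, hρ⟩

lemma exists_cusp_data :
    ∃ (u₀ w₀ k : C0) (c : ℝ), u₀ = ContinuousMap.const _ c + prim k ∧
      w₀ + prim ((derivMap f hf).comp u₀ * w₀) = 1 ∧
      mean ((derivMap f hf).comp u₀ * w₀) = 0 ∧
      mean ((derivMap₂ hf).comp u₀ * w₀) = 0 ∧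
      mean ((derivMap₃ hf).comp u₀ * w₀ * w₀) ≠ 0 := by
  obtain ⟨U, U', ρ, hU, hρ, hmean₁, hmean₂, hmean₃⟩ := exists_oscillation_density hf h₃ h
  obtain ⟨r, w, n, c, hr, hn, hw₀, hw, hwr, hmean₃'⟩ :=
    exists_density_and_solution hρ hmean₁ hmean₃
  obtain ⟨φ, σ, hφ, hσ₀, hσ₁, hσ⟩ := exists_reparametrization hr hn
  have hmean_comp := mean_comp_reparametrization hφ hr hσ hσ₀ hσ₁
  let rinv : C0 := ⟨fun s => (r s)⁻¹, r.continuous.inv₀ fun s => (hr s).ne'⟩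
  have hrinv : U' * rinv * r = U' := ContinuousMap.ext fun s =>
    inv_mul_cancel_right₀ (hr s).ne' (U' s)
  obtain ⟨hu, -⟩ := eq_const_add_prim fun t _ =>
    hasDerivAt_comp_reparametrization hφ hr hσ (Y := U) (Y' := U' * rinv) (by simpa [hrinv]) t
  obtain ⟨hsol, hsol_mean⟩ := eq_const_add_prim fun t _ =>
    hasDerivAt_comp_reparametrization hφ hr hσ hw t
  have hcomp : (-((derivMap f hf).comp U * w)).comp φ
      = -((derivMap f hf).comp (U.comp φ) * w.comp φ) := rfl
  have hφw : w.comp φ ((0 : ℝ) : UnitAddCircle) = 1 := by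
    rw [ContinuousMap.comp_apply, hφ, hσ₀, hw₀]
  rw [hcomp, hφw, map_neg] at hsol
  rw [hcomp, map_neg, neg_eq_zero] at hsol_mean
  refine ⟨U.comp φ, w.comp φ, _, _, hu, ?_, hsol_mean, ?_, ?_⟩
  · nth_rewrite 1 [hsol]
    exact neg_add_cancel_right _ _
  · refine (hmean_comp ((derivMap₂ hf).comp U * w)).trans ?_
    rw [mul_assoc, hwr, mul_smul_comm, map_smul, hmean₂, smul_zero, mul_zero]
  · refine ne_of_eq_of_ne (hmean_comp ((derivMap₃ hf).comp U * w * w)) ?_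
    exact mul_ne_zero (fun hn₀ => by simp [hn₀] at hn) hmean₃'

end CuspData

/-! ### Maps in adapted coordinates -/

section Adapted

lemma surjective_fderiv_pi {E ι : Type*} [NormedAddCommGroup E] [NormedSpace ℝ E] [Unique ι]
    {φ : E → ℝ} {x d : E} (hφ : DifferentiableAt ℝ φ x) (hd : fderiv ℝ φ x d ≠ 0) :
    Function.Surjective (fderiv ℝ (fun p (_ : ι) => φ p) x) := by
  rw [fderiv_pi fun _ => hφ]
  refine fun b => ⟨(b default / fderiv ℝ φ x d) • d, funext fun i => ?_⟩
  rw [ContinuousLinearMap.pi_apply, map_smul, smul_eq_mul, div_mul_cancel₀ _ hd,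
    Unique.eq_default i]

lemma deriv_eq_partialFst {T : Type} [NormedAddCommGroup T] [NormedSpace ℝ T] {h : ℝ × T → ℝ}
    (hh : ContDiff ℝ ∞ h) (v : T) :
    deriv (fun y => h (y, v)) = fun y => partialFst h (y, v) :=
  funext fun y => (hasDerivAt_partialFst hh y v).deriv

variable {E F : Type} [NormedAddCommGroup E] [NormedSpace ℝ E]
  [NormedAddCommGroup F] [NormedSpace ℝ F] {G : E → F}

theorem isCusp_of_adapted {T : Type} [NormedAddCommGroup T] [NormedSpace ℝ T] [CompleteSpace T]
    {Φ : E ≃ ℝ × T} {Ψ : F ≃ ℝ × T} (hΦ : ContDiff ℝ ∞ Φ) (hΦ' : ContDiff ℝ ∞ Φ.symm)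
    (hΨ : ContDiff ℝ ∞ Ψ) (hΨ' : ContDiff ℝ ∞ Ψ.symm) {h : ℝ × T → ℝ} (hh : ContDiff ℝ ∞ h)
    (hG : ∀ q, Ψ (G (Φ.symm q)) = (h q, q.2)) {q d : ℝ × T} (h₁ : partialFst h q = 0)
    (h₂ : partialFst (partialFst h) q = 0) (h₃ : partialFst (partialFst (partialFst h)) q ≠ 0)
    (hd : fderiv ℝ (partialFst h) q d ≠ 0) : IsCusp G (Φ.symm q) := by
  have hh₁ := contDiff_partialFst hh
  let swap := ContinuousLinearEquiv.prodComm ℝ ℝ T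
  let e₁ : E ≃ₜ T × ℝ := Homeomorph.trans ⟨Φ, hΦ.continuous, hΦ'.continuous⟩ swap.toHomeomorph
  let e₀ : F ≃ₜ T × ℝ := Homeomorph.trans ⟨Ψ, hΨ.continuous, hΨ'.continuous⟩ swap.toHomeomorph
  have hq : e₁ (Φ.symm q) = (q.2, q.1) := congrArg swap (Φ.apply_symm_apply q)
  refine ⟨T, inferInstance, inferInstance, inferInstance, e₁.toOpenPartialHomeomorph,
    e₀.toOpenPartialHomeomorph, fun p => h (p.2, p.1),
    ⟨mem_univ _, (swap.contDiff.comp hΦ).contDiffOn, (hΦ'.comp swap.symm.contDiff).contDiffOn⟩,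
    ⟨mem_univ _, (swap.contDiff.comp hΨ).contDiffOn, (hΨ'.comp swap.symm.contDiff).contDiffOn⟩,
    fun _ _ => mem_univ _, (hh.comp swap.symm.contDiff).contDiffOn,
    fun p _ => congrArg swap (hG (swap.symm p)), ?_, ?_, ?_⟩ <;>
    simp only [Homeomorph.toOpenPartialHomeomorph_apply, hq]
  · intro i hi hi'
    interval_cases i
    · rwa [iteratedDeriv_one, deriv_eq_partialFst hh]
    · rwa [iteratedDeriv_succ, iteratedDeriv_one, deriv_eq_partialFst hh,
        deriv_eq_partialFst hh₁]
  · rwa [iteratedDeriv_succ, iteratedDeriv_succ, iteratedDeriv_one, deriv_eq_partialFst hh,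
      deriv_eq_partialFst hh₁, deriv_eq_partialFst (contDiff_partialFst hh₁)]
  · have hfun : (fun (p : T × ℝ) (i : Fin 1) => iteratedDeriv (i.val + 1) (fun y => h (y, p.1)) p.2)
        = fun p _ => (partialFst h ∘ swap.symm) p := by
      funext p i
      rw [Subsingleton.elim i 0, Fin.val_zero, zero_add, iteratedDeriv_one,
        deriv_eq_partialFst hh]
      rfl
    change Function.Surjective (fderiv ℝ (fun (p : T × ℝ) (i : Fin 1) =>
      iteratedDeriv (i.val + 1) (fun y => h (y, p.1)) p.2) (q.2, q.1))
    rw [hfun]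
    refine surjective_fderiv_pi (d := swap d)
      ((hh₁.comp swap.symm.contDiff).differentiable (by simp) _) ?_
    rw [swap.symm.comp_right_fderiv]
    simpa [swap] using hd

theorem isGlobalFold_of_adapted {T : Submodule ℝ F} [CompleteSpace T]
    {Φ : E ≃ ℝ × T} {Ψ : F ≃ ℝ × T} (hΦ : ContDiff ℝ ∞ Φ) (hΦ' : ContDiff ℝ ∞ Φ.symm)
    (hΨ : ContDiff ℝ ∞ Ψ) (hΨ' : ContDiff ℝ ∞ Ψ.symm) {h : ℝ × T → ℝ} (hh : ContDiff ℝ ∞ h)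
    (hG : ∀ q, Ψ (G (Φ.symm q)) = (h q, q.2))
    (hlim : ∀ v, Tendsto (fun y => h (y, v)) (cocompact ℝ) atTop)
    (hcrit : ∀ p, partialFst h p = 0 → 0 < partialFst (partialFst h) p) : IsGlobalFold T G := by
  obtain ⟨Θ, β, hΘ, hΘ', hβ, hΘh⟩ := exists_fold_normal_form hh hlim hcrit
  let e : ℝ × T ≃ ℝ × T :=
    { toFun := fun p => (p.1 - β p.2, p.2)
      invFun := fun p => (p.1 + β p.2, p.2)
      left_inv := fun p => by simp
      right_inv := fun p => by simp }
  refine ⟨Φ.trans Θ, Ψ.trans e, hΘ.comp hΦ, hΦ'.comp hΘ',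
    ((contDiff_fst.sub (hβ.comp contDiff_snd)).prodMk contDiff_snd).comp hΨ,
    hΨ'.comp ((contDiff_fst.add (hβ.comp contDiff_snd)).prodMk contDiff_snd), fun x v => ?_⟩
  obtain ⟨hfst, hsnd⟩ := hΘh (Θ.symm (x, v))
  rw [Equiv.apply_symm_apply] at hfst hsnd
  change e (Ψ (G (Φ.symm (Θ.symm (x, v))))) = _
  rw [hG]
  exact Prod.ext (sub_eq_of_eq_add hfst) hsnd.symm

end Adapted

/-! ### The average of `f ∘ u` as a function of `g = u + prim (f ∘ u)` -/

/-- The average of `f ∘ S g`; here `S` is meant to be the inverse of `addPrim f`. -/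
noncomputable def solutionMean (f : C(ℝ, ℝ)) (S : C0 → C0) (g : C0) : ℝ := mean (f.comp (S g))

section Solution

variable {f : C(ℝ, ℝ)} (hf : ContDiff ℝ ∞ f) {S : C0 → C0} (hS : ContDiff ℝ ∞ S)

include hf in
lemma comp_const_add_prim (c : ℝ) (k : C0) : ∃ (a : ℝ) (k' : C0),
    f.comp (ContinuousMap.const _ c + prim k) = ContinuousMap.const _ a + prim k' := by
  have hderiv : ∀ t : ℝ, HasDerivAt
      (fun t : ℝ => f.comp (ContinuousMap.const _ c + prim k) (t : UnitAddCircle))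
      (((derivMap f hf).comp (ContinuousMap.const _ c + prim k)
        * (k - ContinuousMap.const _ (mean k)) : C0) (t : UnitAddCircle)) t := fun t =>
    (hasDerivAt_derivMap hf _).comp t ((hasDerivAt_prim k t).const_add c)
  exact ⟨_, _, (eq_const_add_prim fun t _ => hderiv t).1⟩

include hf hS in
lemma contDiff_solutionMean : ContDiff ℝ ∞ (solutionMean f S) :=
  mean.contDiff.comp ((contDiff_superposition hf).comp hS)

include hS in
lemma contDiff_line (g : C0) : ContDiff ℝ ∞ fun y : ℝ => S (ContinuousMap.const _ y + g) :=
  hS.comp (contDiff_infty_iff_deriv.mpr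
    ⟨fun y => (hasDerivAt_const_add g y).differentiableAt, by
      rw [show deriv (fun y : ℝ => (ContinuousMap.const _ y + g : C0)) = fun _ => 1 from
        funext fun y => (hasDerivAt_const_add g y).deriv]
      exact contDiff_const⟩)

include hS in
lemma hasFDerivAt_comp_solution (g : C0) : HasFDerivAt (fun g => f.comp (S g))
    ((ContinuousLinearMap.mul ℝ C0 ((derivMap f hf).comp (S g))).comp (fderiv ℝ S g)) g :=
  (hasFDerivAt_comp hf (S g)).comp g ((hS.differentiable (by simp)) g).hasFDerivAt

include hS in
lemma fderiv_solutionMean (g d : C0) : fderiv ℝ (solutionMean f S) g d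
    = mean ((derivMap f hf).comp (S g) * fderiv ℝ S g d) := by
  rw [show solutionMean f S = mean ∘ fun g => f.comp (S g) from rfl,
    (mean.hasFDerivAt.comp g (hasFDerivAt_comp_solution hf hS g)).fderiv]
  rfl

variable (hinv : ∀ g, addPrim f (S g) = g)
include hS hinv

lemma fderiv_solution_add_prim (g d : C0) :
    fderiv ℝ S g d + prim ((derivMap f hf).comp (S g) * fderiv ℝ S g d) = d := by
  have hcomp := (hasFDerivAt_addPrim hf (S g)).comp g
    ((hS.differentiable (by simp)) g).hasFDerivAt
  rw [coe_linEquiv] at hcomp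
  exact DFunLike.congr_fun (hcomp.unique ((hasFDerivAt_id g).congr_of_eventuallyEq
    (Eventually.of_forall hinv))) d

lemma fderiv_solution_linOp (g η : C0) :
    fderiv ℝ S g (linOp ((derivMap f hf).comp (S g)) η) = η := by
  refine (linEquiv ((derivMap f hf).comp (S g))).injective ?_
  rw [← ContinuousLinearEquiv.coe_coe, coe_linEquiv, linOp_apply,
    fderiv_solution_add_prim hf hS hinv]

lemma fderiv_fderiv_solutionMean_mul {g : C0} (h₀ : fderiv ℝ (solutionMean f S) g 1 = 0) (d : C0) :
    fderiv ℝ (fun g => fderiv ℝ (solutionMean f S) g 1) g d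
      * ∫ s in (0 : ℝ)..1, expInt ((derivMap f hf).comp (S g)) s
      = mean ((derivMap₂ hf).comp (S g) * fderiv ℝ S g d) := by
  have hline := fderiv_solution_add_prim hf hS hinv
  let W : C0 → C0 := fun g => fderiv ℝ S g 1
  have hW : HasFDerivAt W (fderiv ℝ W g) g :=
    (((contDiff_infty_iff_fderiv.mp hS).2.clm_apply contDiff_const).differentiable
      (by simp) g).hasFDerivAt
  have hprod : HasFDerivAt (fun g => (derivMap f hf).comp (S g) * W g) _ g :=
    (hasFDerivAt_comp_solution (contDiff_derivMap hf) hS g).mul hW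
  have hval : fderiv ℝ (fun g => fderiv ℝ (solutionMean f S) g 1) g d
      = mean ((derivMap f hf).comp (S g) * fderiv ℝ W g d
        + (derivMap₂ hf).comp (S g) * fderiv ℝ S g d * W g) := by
    rw [show (fun g => fderiv ℝ (solutionMean f S) g 1)
        = mean ∘ fun g => (derivMap f hf).comp (S g) * W g from
      funext fun g => fderiv_solutionMean hf hS g 1, (mean.hasFDerivAt.comp g hprod).fderiv]
    change mean (_ + W g * _) = _
    rw [mul_comm (W g)]
    rfl
  have hrel : fderiv ℝ W g d + prim ((derivMap f hf).comp (S g) * fderiv ℝ W g d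
      + (derivMap₂ hf).comp (S g) * fderiv ℝ S g d * W g) = 0 := by
    have hconst := (hW.add (prim.hasFDerivAt.comp g hprod)).unique
      ((hasFDerivAt_const (1 : C0) g).congr_of_eventuallyEq
        (Eventually.of_forall fun g => hline g 1))
    rw [← mul_comm (W g)]
    exact DFunLike.congr_fun hconst d
  rw [fderiv_solutionMean hf hS] at h₀
  rw [hval]
  exact mean_mul_integral_expInt_of_mul (hline g 1) h₀ hrel

/-- The witness is the direction along which the solution `S g` moves by `f'' ∘ S g`. -/
lemma fderiv_fderiv_solutionMean_ne_zero (h₂ : IsGood 2 f) {g : C0}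
    (h₀ : fderiv ℝ (solutionMean f S) g 1 = 0) :
    fderiv ℝ (fun g => fderiv ℝ (solutionMean f S) g 1) g
      (linOp ((derivMap f hf).comp (S g)) ((derivMap₂ hf).comp (S g))) ≠ 0 := by
  intro hzero
  have hmul := fderiv_fderiv_solutionMean_mul hf hS hinv h₀
    (linOp ((derivMap f hf).comp (S g)) ((derivMap₂ hf).comp (S g)))
  rw [hzero, zero_mul, fderiv_solution_linOp hf hS hinv] at hmul
  have hmean : mean ((derivMap f hf).comp (S g)) = 0 := by
    have hexp := mean_mul_integral_expInt_one (fderiv_solution_add_prim hf hS hinv g 1)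
    rw [← fderiv_solutionMean hf hS, h₀, zero_mul] at hexp
    exact Real.exp_eq_one_iff _ |>.mp (sub_eq_zero.mp hexp.symm)
  obtain ⟨s, hs⟩ := h₂.exists_combination_comp_ne_zero hf hmean (a := 0) (b := 1) one_ne_zero
  rw [zero_mul, zero_add, one_mul] at hs
  exact (mean_pos_of_nonneg (s := s) (fun s => mul_self_nonneg _) (mul_ne_zero hs hs)).ne hmul

end Solution

section Curve

variable {f : C(ℝ, ℝ)} (hf : ContDiff ℝ ∞ f) {u : ℝ → C0} (hu : ContDiff ℝ ∞ u) {g : C0}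
  (hg : ∀ y, addPrim f (u y) = ContinuousMap.const _ y + g)
include hf hu hg

lemma deriv_deriv_mean_pos (h₂ : IsGood 2 f) {a b : ℝ} (hb : 0 < b)
    (hab : ∀ x, 0 ≤ a * derivMap f hf x + b * derivMap₂ hf x) {y : ℝ}
    (hy : deriv (fun y => mean (f.comp (u y))) y = 0) :
    0 < deriv (deriv fun y => mean (f.comp (u y))) y := by
  have hline := deriv_line hf hu hg y
  have hexp := deriv_mean_mul hf hu hg y
  have hderiv₂ := deriv_deriv_mean_mul hf hu hg hy
  rw [hy, zero_mul] at hexp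
  have hmean : mean ((derivMap f hf).comp (u y)) = 0 :=
    Real.exp_eq_one_iff _ |>.mp (sub_eq_zero.mp hexp.symm)
  rw [deriv_mean hf hu, deriv_comp_curve hf hu] at hy
  rw [deriv_comp_curve hf hu] at hline
  have hpos : ∀ s, 0 < deriv u y s := fun s => by
    obtain ⟨t, -, rfl⟩ := exists_mem_Ico_coe s
    exact pos_of_mul_pos_left (zero_lt_one.trans_eq (mul_expInt_eq_one hline hy t).symm)
      (expInt_pos _ _).le
  refine pos_of_mul_pos_left ?_ (integral_expInt_pos ((derivMap f hf).comp (u y))).le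
  rw [hderiv₂]
  exact mean_derivMap₂_comp_mul_pos hf h₂ hb hab hpos hmean hy

end Curve

/-! ### The operator in terms of initial value and derivative -/

/-- The map `(y, v) ↦ y + A v`, where the number `y` stands for a constant function. -/
noncomputable def constAdd {B : Type*} [NormedAddCommGroup B] [NormedSpace ℝ B] (A : B →L[ℝ] C0)
    (T : Submodule ℝ B) : ℝ × T →L[ℝ] C0 :=
  (ContinuousLinearMap.fst ℝ ℝ T).smulRight (1 : C0) +
    A.comp (T.subtypeL.comp (ContinuousLinearMap.snd ℝ ℝ T))

lemma constAdd_apply {B : Type*} [NormedAddCommGroup B] [NormedSpace ℝ B] (A : B →L[ℝ] C0)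
    {T : Submodule ℝ B} (p : ℝ × T) : constAdd A T p = ContinuousMap.const _ p.1 + A p.2 := by
  ext s
  simp [constAdd]

/-- A pair of Banach spaces `E`, `B` of functions and of derivatives on the circle: elements of `E`
are determined by their value at `0` and by their derivative, an element of `B` of average zero. -/
structure CircleModel (E B : Type) [NormedAddCommGroup E] [NormedSpace ℝ E]
    [NormedAddCommGroup B] [NormedSpace ℝ B] where
  /-- The inclusion of continuous functions. -/
  incl : C0 →L[ℝ] B
  /-- The average. -/
  avg : B →L[ℝ] ℝ
  /-- The primitive, vanishing at `0`, of an element minus its average. -/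
  primitive : B →L[ℝ] C0
  avg_incl : ∀ h, avg (incl h) = mean h
  primitive_incl : ∀ h, primitive (incl h) = prim h
  /-- The subspace of elements of average zero. -/
  tilde : Submodule ℝ B
  mem_tilde : ∀ v, v ∈ tilde ↔ avg v = 0
  /-- Value at `0` and derivative. -/
  coord : E ≃L[ℝ] ℝ × tilde

namespace CircleModel

variable {E B : Type} [NormedAddCommGroup E] [NormedSpace ℝ E]
  [NormedAddCommGroup B] [NormedSpace ℝ B] (𝓜 : CircleModel E B)

lemma avg_coe (v : 𝓜.tilde) : 𝓜.avg v = 0 := (𝓜.mem_tilde _).mp v.2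

lemma completeSpace_tilde [CompleteSpace B] : CompleteSpace 𝓜.tilde := by
  have hker : (𝓜.tilde : Set B) = {v | 𝓜.avg v = 0} := Set.ext 𝓜.mem_tilde
  have hclosed : IsClosed (𝓜.tilde : Set B) :=
    hker ▸ isClosed_eq 𝓜.avg.continuous continuous_const
  exact hclosed.completeSpace_coe

/-- The constant function `1` as an element of `B`. -/
noncomputable def one : B := 𝓜.incl 1

lemma avg_one : 𝓜.avg 𝓜.one = 1 := by rw [one, avg_incl, mean_one]

lemma primitive_one : 𝓜.primitive 𝓜.one = 0 := by rw [one, primitive_incl, prim_one]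

/-- The projection onto the elements of average zero. -/
noncomputable def proj : B →L[ℝ] 𝓜.tilde :=
  (ContinuousLinearMap.id ℝ B - 𝓜.avg.smulRight 𝓜.one).codRestrict 𝓜.tilde fun v => by
    rw [mem_tilde]
    simp [avg_one]

lemma coe_proj (v : B) : (𝓜.proj v : B) = v - 𝓜.avg v • 𝓜.one := rfl

lemma primitive_proj_incl (h : C0) : 𝓜.primitive (𝓜.proj (𝓜.incl h)) = prim h := by
  rw [coe_proj, map_sub, map_smul, primitive_one, smul_zero, sub_zero, primitive_incl]

/-- An element of `B` is the sum of its average and of an element of average zero. -/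
noncomputable def split : B ≃L[ℝ] ℝ × 𝓜.tilde :=
  ContinuousLinearEquiv.equivOfInverse (𝓜.avg.prod 𝓜.proj)
    (((ContinuousLinearMap.fst ℝ ℝ 𝓜.tilde).smulRight 𝓜.one) +
      𝓜.tilde.subtypeL.comp (ContinuousLinearMap.snd ℝ ℝ 𝓜.tilde))
    (fun v => by simp [coe_proj])
    (fun p => by
      ext
      · simp [avg_one, avg_coe]
      · simp [coe_proj, avg_one, avg_coe])

lemma split_apply (v : B) : 𝓜.split v = (𝓜.avg v, 𝓜.proj v) := rfl

/-- The function with given value at `0` and given derivative. -/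
noncomputable def fn : ℝ × 𝓜.tilde →L[ℝ] C0 := constAdd 𝓜.primitive 𝓜.tilde

lemma fn_apply (y : ℝ) (v : 𝓜.tilde) :
    𝓜.fn (y, v) = ContinuousMap.const _ y + 𝓜.primitive v :=
  constAdd_apply 𝓜.primitive (y, v)

lemma fn_proj_incl (y : ℝ) (k : C0) :
    𝓜.fn (y, 𝓜.proj (𝓜.incl k)) = ContinuousMap.const _ y + prim k := by
  rw [fn_apply, primitive_proj_incl]

lemma fn_one_zero : 𝓜.fn (1, 0) = 1 := by
  rw [fn_apply, Submodule.coe_zero, map_zero, add_zero]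
  rfl

lemma exists_fn_eq_linOp (q : C0) (a : ℝ) (k : C0) :
    ∃ d, 𝓜.fn d = linOp q (ContinuousMap.const _ a + prim k) :=
  ⟨(a, 𝓜.proj (𝓜.incl (k + q * (ContinuousMap.const _ a + prim k)))), by
    rw [fn_proj_incl, linOp_apply, map_add prim, ← add_assoc]⟩

/-- The operator `u ↦ u' + f ∘ u`. -/
noncomputable def op (f : C(ℝ, ℝ)) (u : E) : B :=
  (𝓜.coord u).2 + 𝓜.incl (f.comp (𝓜.fn (𝓜.coord u)))

variable {f : C(ℝ, ℝ)} {S : C0 → C0}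

lemma fn_add_proj (p : ℝ × 𝓜.tilde) :
    𝓜.fn (p.1, p.2 + 𝓜.proj (𝓜.incl (f.comp (𝓜.fn p)))) = addPrim f (𝓜.fn p) := by
  rw [addPrim, ← Prod.mk.eta (p := p), fn_apply, fn_apply, Submodule.coe_add, map_add,
    primitive_proj_incl, add_assoc]

lemma fn_sub_proj (hinv : ∀ g, addPrim f (S g) = g) (q : ℝ × 𝓜.tilde) :
    𝓜.fn (q.1, q.2 - 𝓜.proj (𝓜.incl (f.comp (S (𝓜.fn q))))) = S (𝓜.fn q) := by
  rw [fn_apply, Submodule.coe_sub, map_sub, primitive_proj_incl, ← add_sub_assoc, ← fn_apply]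
  exact sub_eq_iff_eq_add.mpr (hinv (𝓜.fn q)).symm

section Straighten

variable (hinv : ∀ g, addPrim f (S g) = g) (hinv' : ∀ u, S (addPrim f u) = u)

/-- The change of variables sending `u`, given by its initial value and its derivative, to its
initial value and to the projection of `u' + f ∘ u`. -/
noncomputable def straighten : ℝ × 𝓜.tilde ≃ ℝ × 𝓜.tilde where
  toFun p := (p.1, p.2 + 𝓜.proj (𝓜.incl (f.comp (𝓜.fn p))))
  invFun q := (q.1, q.2 - 𝓜.proj (𝓜.incl (f.comp (S (𝓜.fn q)))))
  left_inv p := by simp only [fn_add_proj, hinv', add_sub_cancel_right]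
  right_inv q := by simp only [𝓜.fn_sub_proj hinv, sub_add_cancel]

lemma contDiff_straighten (hf : ContDiff ℝ ∞ f) : ContDiff ℝ ∞ (𝓜.straighten hinv hinv') :=
  contDiff_fst.prodMk (contDiff_snd.add (𝓜.proj.contDiff.comp (𝓜.incl.contDiff.comp
    ((contDiff_superposition hf).comp 𝓜.fn.contDiff))))

lemma contDiff_straighten_symm (hf : ContDiff ℝ ∞ f) (hS : ContDiff ℝ ∞ S) :
    ContDiff ℝ ∞ (𝓜.straighten hinv hinv').symm :=
  contDiff_fst.prodMk (contDiff_snd.sub (𝓜.proj.contDiff.comp (𝓜.incl.contDiff.comp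
    ((contDiff_superposition hf).comp (hS.comp 𝓜.fn.contDiff)))))

/-- The average of `u' + f ∘ u` as a function of the initial value of `u` and of the projection of
`u' + f ∘ u`. -/
noncomputable def height (f : C(ℝ, ℝ)) (S : C0 → C0) (q : ℝ × 𝓜.tilde) : ℝ :=
  solutionMean f S (𝓜.fn q)

lemma split_op (q : ℝ × 𝓜.tilde) :
    𝓜.split (𝓜.op f (𝓜.coord.symm ((𝓜.straighten hinv hinv').symm q)))
      = (𝓜.height f S q, q.2) := by
  set p := (𝓜.straighten hinv hinv').symm q
  have hfn : 𝓜.fn p = S (𝓜.fn q) := 𝓜.fn_sub_proj hinv q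
  have hproj : 𝓜.proj (p.2 : B) = p.2 := Subtype.ext (by simp [coe_proj, avg_coe])
  rw [split_apply, op, ContinuousLinearEquiv.apply_symm_apply, map_add, map_add, avg_coe,
    zero_add, avg_incl, hproj, hfn]
  exact Prod.ext rfl (sub_add_cancel _ _)

end Straighten

lemma height_line (v : 𝓜.tilde) : (fun y => 𝓜.height f S (y, v))
    = fun y => mean (f.comp (S (ContinuousMap.const _ y + 𝓜.primitive v))) :=
  funext fun y => by rw [height, fn_apply, solutionMean]

variable (hf : ContDiff ℝ ∞ f) (hS : ContDiff ℝ ∞ S)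
include hf hS

lemma contDiff_height : ContDiff ℝ ∞ (𝓜.height f S) :=
  (contDiff_solutionMean hf hS).comp 𝓜.fn.contDiff

lemma partialFst_height :
    partialFst (𝓜.height f S) = fun q => fderiv ℝ (solutionMean f S) (𝓜.fn q) 1 := by
  funext q
  have hcomp := ((contDiff_solutionMean hf hS).differentiable
    (by simp) (𝓜.fn q)).hasFDerivAt.comp q 𝓜.fn.hasFDerivAt
  rw [← 𝓜.fn_one_zero]
  exact DFunLike.congr_fun hcomp.fderiv _

lemma fderiv_partialFst_height (q d : ℝ × 𝓜.tilde) :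
    fderiv ℝ (partialFst (𝓜.height f S)) q d
      = fderiv ℝ (fun g => fderiv ℝ (solutionMean f S) g 1) (𝓜.fn q) (𝓜.fn d) := by
  have hsmooth : ContDiff ℝ ∞ fun g => fderiv ℝ (solutionMean f S) g 1 :=
    (contDiff_infty_iff_fderiv.mp (contDiff_solutionMean hf hS)).2.clm_apply contDiff_const
  have hcomp := (hsmooth.differentiable (by simp) _).hasFDerivAt.comp q 𝓜.fn.hasFDerivAt
  rw [partialFst_height 𝓜 hf hS]
  exact DFunLike.congr_fun hcomp.fderiv d

lemma exists_fderiv_partialFst_height_ne_zero (h₂ : IsGood 2 f)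
    (hinv : ∀ g, addPrim f (S g) = g) {q : ℝ × 𝓜.tilde} {c : ℝ} {k : C0}
    (hq : S (𝓜.fn q) = ContinuousMap.const _ c + prim k)
    (h₀ : partialFst (𝓜.height f S) q = 0) :
    ∃ d, fderiv ℝ (partialFst (𝓜.height f S)) q d ≠ 0 := by
  obtain ⟨a, k', hk'⟩ := comp_const_add_prim (contDiff_derivMap (contDiff_derivMap hf)) c k
  obtain ⟨d, hd⟩ := 𝓜.exists_fn_eq_linOp ((derivMap f hf).comp (S (𝓜.fn q))) a k'
  refine ⟨d, ?_⟩
  rw [← hk', ← hq] at hd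
  rw [fderiv_partialFst_height 𝓜 hf hS, hd]
  exact fderiv_fderiv_solutionMean_ne_zero hf hS hinv h₂
    ((congrFun (𝓜.partialFst_height hf hS) q).symm.trans h₀)

omit hS in
theorem isGlobalFold [CompleteSpace B] (h₂ : IsGood 2 f) (hlim : Tendsto f (cocompact ℝ) atTop)
    (h : (0 : Fin 2 → ℝ) ∉ interior (convexHull ℝ (range (gammaHat 2 f)))) :
    IsGlobalFold 𝓜.tilde (𝓜.op f) := by
  have := 𝓜.completeSpace_tilde
  obtain ⟨S, hS, hinv, hinv'⟩ := exists_contDiff_inverse_addPrim hlim hf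
  obtain ⟨a, b, hb, hab⟩ := h₂.exists_combination_nonneg hf hlim h
  have hh := 𝓜.contDiff_height hf hS
  refine isGlobalFold_of_adapted (Φ := 𝓜.coord.toEquiv.trans (𝓜.straighten hinv hinv'))
    (Ψ := 𝓜.split.toEquiv) ((𝓜.contDiff_straighten hinv hinv' hf).comp 𝓜.coord.contDiff)
    (𝓜.coord.symm.contDiff.comp (𝓜.contDiff_straighten_symm hinv hinv' hf hS))
    𝓜.split.contDiff 𝓜.split.symm.contDiff hh (𝓜.split_op hinv hinv') (fun v => ?_) ?_
  · rw [height_line]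
    exact tendsto_mean_comp hlim hinv _
  · rintro ⟨y, v⟩ hy
    rw [← congrFun (deriv_eq_partialFst hh v) y, height_line] at hy
    rw [← congrFun (deriv_eq_partialFst (contDiff_partialFst hh) v) y,
      ← deriv_eq_partialFst hh v, height_line]
    exact deriv_deriv_mean_pos hf (contDiff_line hS _) (fun y => hinv _) h₂ hb hab hy

lemma partialFst_height_of_cusp_data (hinv : ∀ g, addPrim f (S g) = g) {u₀ w₀ : C0} {c : ℝ}
    {v₀ : 𝓜.tilde} (hu₀ : S (𝓜.fn (c, v₀)) = u₀)
    (hw₀ : w₀ + prim ((derivMap f hf).comp u₀ * w₀) = 1)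
    (hmean₁ : mean ((derivMap f hf).comp u₀ * w₀) = 0)
    (hmean₂ : mean ((derivMap₂ hf).comp u₀ * w₀) = 0)
    (hmean₃ : mean ((derivMap₃ hf).comp u₀ * w₀ * w₀) ≠ 0) :
    partialFst (𝓜.height f S) (c, v₀) = 0 ∧
      partialFst (partialFst (𝓜.height f S)) (c, v₀) = 0 ∧
      partialFst (partialFst (partialFst (𝓜.height f S))) (c, v₀) ≠ 0 := by
  have hh := 𝓜.contDiff_height hf hS
  have hh₁ := contDiff_partialFst hh
  have hu := contDiff_line hS (𝓜.primitive v₀)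
  have hg := fun y => hinv (ContinuousMap.const _ y + 𝓜.primitive v₀)
  rw [fn_apply] at hu₀
  have hvel : deriv (fun y : ℝ => S (ContinuousMap.const _ y + 𝓜.primitive v₀)) c = w₀ := by
    have hline := deriv_line hf hu hg c
    simp only [deriv_comp_curve hf hu, hu₀] at hline
    refine (linEquiv ((derivMap f hf).comp u₀)).injective ?_
    rw [← ContinuousLinearEquiv.coe_coe, coe_linEquiv]
    exact hline.trans hw₀.symm
  rw [← congrFun (deriv_eq_partialFst hh v₀) c, ← congrFun (deriv_eq_partialFst hh₁ v₀) c,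
    ← congrFun (deriv_eq_partialFst (contDiff_partialFst hh₁) v₀) c, ← deriv_eq_partialFst hh₁ v₀,
    ← deriv_eq_partialFst hh v₀, height_line]
  have hderiv₁ : deriv (fun y : ℝ =>
      mean (f.comp (S (ContinuousMap.const _ y + 𝓜.primitive v₀)))) c = 0 := by
    simp only [deriv_mean hf hu, deriv_comp_curve hf hu, hu₀, hvel, hmean₁]
  have hmul₂ := deriv_deriv_mean_mul hf hu hg hderiv₁
  rw [hu₀, hvel, hmean₂] at hmul₂
  have hderiv₂ := (mul_eq_zero.mp hmul₂).resolve_right (integral_expInt_pos _).ne'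
  have hmul₃ := deriv_deriv_deriv_mean_mul hf hu hg hderiv₁ hderiv₂
  rw [hu₀, hvel] at hmul₃
  exact ⟨hderiv₁, hderiv₂, fun hzero => hmean₃ (by rw [← hmul₃, hzero, zero_mul])⟩

omit hS in
theorem exists_isCusp [CompleteSpace B] (h₂ : IsGood 2 f) (h₃ : IsGood 3 f)
    (hlim : Tendsto f (cocompact ℝ) atTop)
    (h : (0 : Fin 2 → ℝ) ∈ interior (convexHull ℝ (range (gammaHat 2 f)))) :
    ∃ z : E, IsCusp (𝓜.op f) z := by
  have := 𝓜.completeSpace_tilde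
  obtain ⟨S, hS, hinv, hinv'⟩ := exists_contDiff_inverse_addPrim hlim hf
  obtain ⟨u₀, w₀, k, c, hu₀, hw₀, hmean₁, hmean₂, hmean₃⟩ := exists_cusp_data hf h₃ h
  have hSu : S (𝓜.fn (c, 𝓜.proj (𝓜.incl (k + f.comp u₀)))) = u₀ := by
    rw [fn_proj_incl, map_add prim, ← add_assoc, ← hu₀]
    exact hinv' u₀
  obtain ⟨hpartial₁, hpartial₂, hpartial₃⟩ :=
    𝓜.partialFst_height_of_cusp_data hf hS hinv hSu hw₀ hmean₁ hmean₂ hmean₃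
  obtain ⟨d, hd⟩ := 𝓜.exists_fderiv_partialFst_height_ne_zero hf hS h₂ hinv (hSu.trans hu₀)
    hpartial₁
  exact ⟨_, isCusp_of_adapted (Φ := 𝓜.coord.toEquiv.trans (𝓜.straighten hinv hinv'))
    (Ψ := 𝓜.split.toEquiv) ((𝓜.contDiff_straighten hinv hinv' hf).comp 𝓜.coord.contDiff)
    (𝓜.coord.symm.contDiff.comp (𝓜.contDiff_straighten_symm hinv hinv' hf hS))
    𝓜.split.contDiff 𝓜.split.symm.contDiff (𝓜.contDiff_height hf hS) (𝓜.split_op hinv hinv')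
    hpartial₁ hpartial₂ hpartial₃ hd⟩

end CircleModel

/-! ### The two function spaces -/

lemma C1.eq_const_add_prim (u : C1) :
    u.1.1 = ContinuousMap.const _ (u.1.1 ((0 : ℝ) : UnitAddCircle)) + prim u.1.2
      ∧ mean u.1.2 = 0 := PeriodicODE.eq_const_add_prim fun t _ => u.2 t

lemma mem_C0tilde (v : C0) : v ∈ C0tilde ↔ mean v = 0 := by
  rw [mean_eq_integral]
  rfl

lemma constAdd_prim_mem_C1 (p : ℝ × C0tilde) : (constAdd prim C0tilde p, (p.2 : C0)) ∈ C1 :=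
  fun t => by
    have hderiv := (hasDerivAt_prim (p.2 : C0) t).const_add p.1
    rw [(mem_C0tilde _).mp p.2.2, sub_zero] at hderiv
    rw [constAdd_apply]
    exact hderiv

/-- The space `C¹` in terms of initial values and derivatives. -/
noncomputable def C1.coord : C1 ≃L[ℝ] ℝ × C0tilde :=
  ContinuousLinearEquiv.equivOfInverse
    (((ContinuousMap.evalCLM ℝ ((0 : ℝ) : UnitAddCircle)).comp
      ((ContinuousLinearMap.fst ℝ C0 C0).comp C1.subtypeL)).prod
      (((ContinuousLinearMap.snd ℝ C0 C0).comp C1.subtypeL).codRestrict C0tilde fun u =>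
        (mem_C0tilde _).mpr (C1.eq_const_add_prim u).2))
    (((constAdd prim C0tilde).prod
      (C0tilde.subtypeL.comp (ContinuousLinearMap.snd ℝ ℝ C0tilde))).codRestrict C1
        constAdd_prim_mem_C1)
    (fun u => Subtype.ext (Prod.ext
      ((constAdd_apply _ _).trans (C1.eq_const_add_prim u).1.symm) rfl))
    (fun p => Prod.ext (by
      change constAdd prim C0tilde p ((0 : ℝ) : UnitAddCircle) = p.1
      rw [constAdd_apply, ContinuousMap.add_apply, prim_zero, add_zero, ContinuousMap.const_apply])
      rfl)

/-- The spaces `C¹` and `C⁰` as a `CircleModel`. -/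
noncomputable def modelC : CircleModel C1 C0 where
  incl := ContinuousLinearMap.id ℝ C0
  avg := mean
  primitive := prim
  avg_incl _ := rfl
  primitive_incl _ := rfl
  tilde := C0tilde
  mem_tilde := mem_C0tilde
  coord := C1.coord

lemma modelC_op (f : C(ℝ, ℝ)) : modelC.op f = opC f := by
  funext u
  have hfn : modelC.fn (modelC.coord u) = u.1.1 :=
    congrArg (fun u : C1 => u.1.1) (C1.coord.symm_apply_apply u)
  rw [CircleModel.op, hfn]
  rfl

lemma mem_H0tilde (v : H0) : v ∈ H0tilde ↔ meanH v = 0 := Iff.rfl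

lemma H1.eq_const_add_primH (u : H1) :
    u.fn = ContinuousMap.const _ (u.fn ((0 : ℝ) : UnitAddCircle)) + primH u.der
      ∧ meanH u.der = 0 := by
  have hftc : ∀ t ∈ Icc (0 : ℝ) 1, u.fn (t : UnitAddCircle) = u.fn ((0 : ℝ) : UnitAddCircle)
      + ∫ s in (0 : ℝ)..t, u.der (s : UnitAddCircle) := u.2
  have hmean : meanH u.der = 0 := by
    have hone := hftc 1 ⟨zero_le_one, le_rfl⟩
    rw [coe_one_circle] at hone
    rw [meanH_eq]
    exact left_eq_add.mp hone
  refine ⟨C0.ext_Icc fun t ht => ?_, hmean⟩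
  rw [ContinuousMap.add_apply, ContinuousMap.const_apply, primH_apply _ ht, hmean, hftc t ht,
    mul_zero, sub_zero]

lemma constAdd_primH_mem_H1pairs (p : ℝ × H0tilde) :
    (constAdd primH H0tilde p, (p.2 : H0)) ∈ H1pairs := fun t ht => by
  simp only [constAdd_apply, ContinuousMap.add_apply, ContinuousMap.const_apply]
  rw [primH_zero, primH_apply _ ht, (mem_H0tilde _).mp p.2.2, mul_zero, sub_zero, add_zero]

lemma H1.isometry_toL2 : Isometry H1.toL2 := AddMonoidHomClass.isometry_of_norm _ fun _ => rfl

/-- The pair formed by a function in `H¹` and its derivative, as elements of `L²`. -/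
noncomputable def H1.pairL : H1 →L[ℝ] H0 × H0 :=
  (WithLp.prodContinuousLinearEquiv 2 ℝ H0 H0 : WithLp 2 (H0 × H0) →L[ℝ] H0 × H0).comp
    ⟨H1.toL2, H1.isometry_toL2.continuous⟩

/-- The value at `0` of a function `u` in `H¹`, encoded as the mean of `u` minus the mean of the
primitive of `u'`: in this form its continuity for the Hilbert norm is manifest. -/
noncomputable def H1.valueZero : H1 →L[ℝ] ℝ :=
  meanH.comp ((ContinuousLinearMap.fst ℝ H0 H0).comp H1.pairL)
    - (mean.comp primH).comp ((ContinuousLinearMap.snd ℝ H0 H0).comp H1.pairL)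

lemma H1.valueZero_apply (u : H1) : H1.valueZero u = u.fn ((0 : ℝ) : UnitAddCircle) := by
  change mean u.fn - mean (primH u.der) = _
  conv_lhs => rw [u.eq_const_add_primH.1, map_add, add_sub_cancel_right]
  rw [mean_eq]
  simp

/-- The element of `H¹` with given value at `0` and given derivative. -/
noncomputable def H1.ofCoord : ℝ × H0tilde →ₗ[ℝ] H1 :=
  LinearMap.codRestrict H1pairs ((constAdd primH H0tilde).prod
    (H0tilde.subtypeL.comp (ContinuousLinearMap.snd ℝ ℝ H0tilde))).toLinearMap
    constAdd_primH_mem_H1pairs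

lemma H1.fn_ofCoord (p : ℝ × H0tilde) :
    (H1.ofCoord p).fn = ContinuousMap.const _ p.1 + primH p.2 := constAdd_apply primH p

lemma H1.continuous_ofCoord : Continuous H1.ofCoord := by
  rw [H1.isometry_toL2.isUniformInducing.isInducing.continuous_iff]
  have hcomp : (H1.toL2 ∘ H1.ofCoord : ℝ × H0tilde → WithLp 2 (H0 × H0)) =
      fun p => WithLp.toLp 2 (inclH (constAdd primH H0tilde p), (p.2 : H0)) := rfl
  rw [hcomp]
  exact (WithLp.prod_continuous_toLp 2 H0 H0).comp (by fun_prop)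

/-- The space `H¹` in terms of initial values and derivatives. -/
noncomputable def H1.coord : H1 ≃L[ℝ] ℝ × H0tilde :=
  ContinuousLinearEquiv.equivOfInverse
    (H1.valueZero.prod
      (((ContinuousLinearMap.snd ℝ H0 H0).comp H1.pairL).codRestrict H0tilde fun u =>
        u.eq_const_add_primH.2))
    ⟨H1.ofCoord, H1.continuous_ofCoord⟩
    (fun u => by
      refine Subtype.ext (Prod.ext ((H1.fn_ofCoord _).trans ?_) rfl)
      change ContinuousMap.const _ (H1.valueZero u) + primH u.der = _
      rw [H1.valueZero_apply]
      exact u.eq_const_add_primH.1.symm)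
    (fun p => by
      refine Prod.ext ?_ rfl
      change H1.valueZero (H1.ofCoord p) = p.1
      rw [H1.valueZero_apply, H1.fn_ofCoord, ContinuousMap.add_apply, primH_zero, add_zero,
        ContinuousMap.const_apply])

/-- The spaces `H¹` and `L²` as a `CircleModel`. -/
noncomputable def modelH : CircleModel H1 H0 where
  incl := inclH
  avg := meanH
  primitive := primH
  avg_incl _ := rfl
  primitive_incl _ := rfl
  tilde := H0tilde
  mem_tilde := mem_H0tilde
  coord := H1.coord

lemma modelH_op (f : C(ℝ, ℝ)) : modelH.op f = opH f := by
  funext u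
  have hfn : modelH.fn (modelH.coord u) = u.fn :=
    congrArg H1.fn (H1.coord.symm_apply_apply u)
  rw [CircleModel.op, hfn]
  rfl

end PeriodicODE

theorem theorem4p3 (f : ℝ → ℝ) (hf : ContDiff ℝ ∞ f)
    (h2 : PeriodicODE.IsGood 2 f) (h3 : PeriodicODE.IsGood 3 f)
    (htop : Tendsto f atTop atTop) (hbot : Tendsto f atBot atTop) :
    ((0 : Fin 2 → ℝ) ∈ interior (convexHull ℝ (range (PeriodicODE.gammaHat 2 f))) →
      (∃ u : PeriodicODE.C1, PeriodicODE.IsCusp (PeriodicODE.opC ⟨f, hf.continuous⟩) u) ∧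
      (∃ u : PeriodicODE.H1, PeriodicODE.IsCusp (PeriodicODE.opH ⟨f, hf.continuous⟩) u)) ∧
    ((0 : Fin 2 → ℝ) ∉ interior (convexHull ℝ (range (PeriodicODE.gammaHat 2 f))) →
      PeriodicODE.IsGlobalFold PeriodicODE.C0tilde (PeriodicODE.opC ⟨f, hf.continuous⟩) ∧
      PeriodicODE.IsGlobalFold PeriodicODE.H0tilde (PeriodicODE.opH ⟨f, hf.continuous⟩)) := by
  have hlim : Tendsto f (cocompact ℝ) atTop := by
    rw [cocompact_eq_atBot_atTop]
    exact hbot.sup htop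
  rw [← PeriodicODE.modelC_op, ← PeriodicODE.modelH_op]
  exact ⟨fun h => ⟨PeriodicODE.modelC.exists_isCusp hf h2 h3 hlim h,
      PeriodicODE.modelH.exists_isCusp hf h2 h3 hlim h⟩,
    fun h => ⟨PeriodicODE.modelC.isGlobalFold hf h2 hlim h,
      PeriodicODE.modelH.isGlobalFold hf h2 hlim h⟩⟩
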